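/- **Setting.** Let $\bar X\in\mathbb R^{n\times d}$ be a fixed matrix whose columns have Euclidean norm at most $\sqrt n$, let $\bar\beta\in\mathbb R^d$ with $\bar s=\|\bar\beta\|_0$, and let $\bar y=\bar X\bar\beta+\varepsilon$, where the entries of $\varepsilon$ are i.i.d. sub-Gaussian with variance proxy $\sigma^2$ (i.e. $\mathbb E e^{t\varepsilon_i}\le e^{\sigma^2t^2/2}$ for all $t\in\mathbb R$), $\sigma>0$. Put $X=\bar X/\sqrt n$, $y=\bar y/\sqrt n$, $r=\operatorname{rank}X$, and $\|v\|_X=\|Xv\|_2$. For $s\ge1$ let $\rho_+(s)$ and $\rho_-(s)$ be the supremum and the infimum of $v^\top X^\top Xv$ over all $v\in\mathbb R^d$ with $\|v\|_2=1$ and $\|v\|_0\le s$. Assume that there is an integer $k^*\ge 2\bar s$ with $\rho_-(2k^*+\bar s)>0$ and $$\frac{\rho_+(k^*)}{\rho_-(2k^*+\bar s)}\le 1+\frac{0.5\,k^*}{\bar s}$$ (the last condition being void if $\bar s=0$). Let $c,\mu>0$ with $\mu+2/c<1$, let $\gamma=\dfrac{1+\mu+2/c}{1-\mu-2/c}$,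 and suppose $\gamma\sqrt{0.5}<1$. Let $\lambda=c\,\sigma\sqrt{\log d/n}$, let $\rho,\delta\in(0,1)$, and let $\beta^*$ be a minimizer of the Lasso objective $\tfrac12\|y-X\beta\|_2^2+\lambda\|\beta\|_1$. Let $P\in\mathbb R^{\tilde n\times n}$ be a random matrix and $\tilde X=PX$. Iterative SRO for the Lasso, which uses the same $P$ throughout, starts at $\beta^{(0)}=0$ and takes for $t=1,\dots,N$ $$\beta^{(t)}\in\operatorname*{argmin}_{\beta\in\mathbb R^d}\ \tfrac12\big\|\tilde X(\beta-\beta^{(t-1)})\big\|_2^2-\big\langle y-X\beta^{(t-1)},X\beta\big\rangle+\lambda\|\beta\|_1 .$$ It returns $\tilde\beta^*=\beta^{(N)}$, where $N$ is any integer with $$N\ \ge\ 1+\max\left\{0,\ \left\lfloor \frac{\log\big(\|X\|_2\,\|\beta^*\|_X/(\lambda\mu)\big)}{\log(1/\rho)}\right\rfloor\right\}$$ (the maximum is read as $0$ if $\|\beta^*\|_X=0$). **Theorem.** There is a universal constant $C>0$ such that the following holds in the above setting. Suppose that one of these conditions is satisfied: 1. with probability at least $1-\delta$, $P$ is a $(1\pm\epsilon)$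 $\ell^2$-subspace embedding for $X$ with $\epsilon=\rho/(\rho+1)$, that is, $(1-\epsilon)\|X\beta\|_2^2\le\|PX\beta\|_2^2\le(1+\epsilon)\|X\beta\|_2^2$ for all $\beta\in\mathbb R^d$; 2. $P=P'/\sqrt{\tilde n}$ where $P'$ has i.i.d. standard Gaussian entries, and $\tilde n\ge C\,\big(r+\log\tfrac1\delta\big)\,(\rho+1)^2/\rho^2$; 3. $P$ is a sparse subspace embedding (column $i$ has a single nonzero entry, in a uniformly random row and with a uniformly random sign $\pm1$, all rows and signs being independent), and $\tilde n\ge C\,\tfrac{r^2}{\delta}\,(\rho+1)^2/\rho^2$. Then, with probability at least $1-\delta-2/d$, for every such $\beta^*$, every such $N$ and every run of Iterative SRO, $$\|\tilde\beta^*-\bar\beta\|_2\ \le\ \frac{\sigma\,(c+\mu c+2)}{\rho_-(\bar s+k^*)\,\big(1-\gamma\sqrt{0.5}\big)}\ \sqrt{\frac{\bar s\log d}{n}} .$$ -/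

import Mathlib

open MeasureTheory ProbabilityTheory
open scoped Matrix NNReal

noncomputable section

namespace SketchedLasso

/-- The Euclidean norm `‖v‖₂` of a vector. -/
def l2norm {ι : Type*} [Fintype ι] (v : ι → ℝ) : ℝ := ‖WithLp.toLp 2 v‖

/-- The norm `‖v‖₁` of a vector. -/
def l1norm {ι : Type*} [Fintype ι] (v : ι → ℝ) : ℝ := ∑ i, |v i|

/-- The spectral norm `‖X‖₂` of a matrix. -/
def opNorm2 {n d : ℕ} (X : Matrix (Fin n) (Fin d) ℝ) : ℝ :=
  @norm _ (Matrix.instL2OpNormedAddCommGroup (𝕜 := ℝ)).toNorm X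

/-- The seminorm `‖v‖_X = ‖X v‖₂`. -/
def dataNorm {n d : ℕ} (X : Matrix (Fin n) (Fin d) ℝ) (v : Fin d → ℝ) : ℝ :=
  l2norm (X *ᵥ v)

/-- The largest `s`-sparse eigenvalue of `Xᵀ X` (for `s ≥ 1`). -/
def sparseEigMax {n d : ℕ} (X : Matrix (Fin n) (Fin d) ℝ) (s : ℕ) : ℝ :=
  sSup {r : ℝ | ∃ v : Fin d → ℝ,
    hammingNorm v ≤ s ∧ l2norm v = 1 ∧ r = v ⬝ᵥ ((Xᵀ * X) *ᵥ v)}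

/-- The smallest `s`-sparse eigenvalue of `Xᵀ X` (for `s ≥ 1`). -/
def sparseEigMin {n d : ℕ} (X : Matrix (Fin n) (Fin d) ℝ) (s : ℕ) : ℝ :=
  sInf {r : ℝ | ∃ v : Fin d → ℝ,
    hammingNorm v ≤ s ∧ l2norm v = 1 ∧ r = v ⬝ᵥ ((Xᵀ * X) *ᵥ v)}

/-- The sparse eigenvalue condition for sparsity level `s` and the integer `k`.
For `s = 0` the right-hand side `1 + 0.5 k / s` is read as `+∞`. -/
structure SparseEigenvalueCondition {n d : ℕ} (X : Matrix (Fin n) (Fin d) ℝ)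
    (s k : ℕ) : Prop where
  two_mul_le : 2 * s ≤ k
  sparseEigMin_pos : 0 < sparseEigMin X (2 * k + s)
  ratio_le : 0 < s →
    sparseEigMax X k / sparseEigMin X (2 * k + s) ≤ 1 + 0.5 * (k : ℝ) / (s : ℝ)

/-- The objective `½ ‖y - X β‖₂² + h β` of the regularized least square problem. -/
def objective {n d : ℕ} (X : Matrix (Fin n) (Fin d) ℝ) (y : Fin n → ℝ)
    (h : (Fin d → ℝ) → ℝ) (β : Fin d → ℝ) : ℝ :=
  1 / 2 * l2norm (y - X *ᵥ β) ^ 2 + h β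

/-- The objective `½ ‖X̃ (β - b)‖₂² - ⟨y - X b, X β⟩ + h β` minimized in one step of
Iterative SRO, where `b` is the previous iterate and `Xs = X̃` is the sketch of `X`. -/
def stepObjective {m n d : ℕ} (X : Matrix (Fin n) (Fin d) ℝ) (Xs : Matrix (Fin m) (Fin d) ℝ)
    (y : Fin n → ℝ) (h : (Fin d → ℝ) → ℝ) (b β : Fin d → ℝ) : ℝ :=
  1 / 2 * l2norm (Xs *ᵥ (β - b)) ^ 2 - (y - X *ᵥ b) ⬝ᵥ (X *ᵥ β) + h β

/-- `β 0, …, β N` are the iterates of a run of Iterative SRO with `N` iterations: it starts at `0`,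
and every iterate is a global minimizer of the step objective given by its predecessor. -/
def IsIterativeSRORun {m n d : ℕ} (X : Matrix (Fin n) (Fin d) ℝ)
    (Xs : Matrix (Fin m) (Fin d) ℝ) (y : Fin n → ℝ) (h : (Fin d → ℝ) → ℝ) (N : ℕ)
    (β : ℕ → Fin d → ℝ) : Prop :=
  β 0 = 0 ∧
    ∀ t, 1 ≤ t → t ≤ N → IsMinOn (stepObjective X Xs y h (β (t - 1))) Set.univ (β t)

/-- The number of iterations `1 + log (‖X‖₂ ‖β*‖_X / (lam μ)) / log (1 / ρ)`, rounded down to an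
integer, and at least `1`. -/
def iterationNumber {n d : ℕ} (X : Matrix (Fin n) (Fin d) ℝ) (lam μ ρ : ℝ)
    (βstar : Fin d → ℝ) : ℕ :=
  1 + ⌊Real.log (opNorm2 X * dataNorm X βstar / (lam * μ)) / Real.log (1 / ρ)⌋₊

/-- `P` is a `(1 ± ε)` `ℓ²`-subspace embedding for `X`. -/
def IsSubspaceEmbedding {m n d : ℕ} (ε : ℝ) (P : Matrix (Fin m) (Fin n) ℝ)
    (X : Matrix (Fin n) (Fin d) ℝ) : Prop :=
  ∀ β : Fin d → ℝ,
    (1 - ε) * l2norm (X *ᵥ β) ^ 2 ≤ l2norm (P *ᵥ (X *ᵥ β)) ^ 2 ∧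
      l2norm (P *ᵥ (X *ᵥ β)) ^ 2 ≤ (1 + ε) * l2norm (X *ᵥ β) ^ 2

/-- The random matrix `P` is, with probability at least `1 - δ`, a `(1 ± ε)` `ℓ²`-subspace
embedding for `X`. A matrix drawn from an `(ε, δ)` oblivious `ℓ²`-subspace embedding
has this property for every fixed `X`. -/
def IsRandomSubspaceEmbedding {Ω : Type*} [MeasurableSpace Ω] (Pr : Measure Ω) {m n d : ℕ}
    (ε δ : ℝ) (P : Ω → Matrix (Fin m) (Fin n) ℝ) (X : Matrix (Fin n) (Fin d) ℝ) : Prop :=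
  (∀ i j, AEMeasurable (fun ω => P ω i j) Pr) ∧
    1 - δ ≤ Pr.real {ω | IsSubspaceEmbedding ε (P ω) X}

/-- `P = G / √m` where the `m × n` entries of `G` are i.i.d. standard Gaussian. -/
def IsGaussianSketch {Ω : Type*} [MeasurableSpace Ω] (Pr : Measure Ω) {m n : ℕ}
    (P : Ω → Matrix (Fin m) (Fin n) ℝ) : Prop :=
  ∃ G : Ω → Matrix (Fin m) (Fin n) ℝ,
    (∀ i j, HasLaw (fun ω => G ω i j) (gaussianReal 0 1) Pr) ∧
    iIndepFun (fun (p : Fin m × Fin n) ω => G ω p.1 p.2) Pr ∧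
    ∀ ω, P ω = (√(m : ℝ))⁻¹ • G ω

/-- For every column index `i`, independently, a row `h i` uniform on the `m` rows and an
independent uniform sign (`1` or `-1`, encoded by the Boolean `s i`) are drawn; `P` has it at `(h i, i)` and
zeros elsewhere in column `i`. -/
def IsSparseSketch {Ω : Type*} [MeasurableSpace Ω] (Pr : Measure Ω) {m n : ℕ}
    (P : Ω → Matrix (Fin m) (Fin n) ℝ) : Prop :=
  ∃ (h : Ω → Fin n → Fin m) (s : Ω → Fin n → Bool),
    (∀ i, HasLaw (fun ω => (h ω i, s ω i)) (uniformOn (Set.univ : Set (Fin m × Bool))) Pr) ∧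
    iIndepFun (fun (i : Fin n) ω => (h ω i, s ω i)) Pr ∧
    ∀ ω j i, P ω j i = if j = h ω i then (if s ω i then 1 else -1) else 0

/-- The three kinds of sketches allowed for accuracy `ρ`, failure probability `δ`, and the
constant `C` hidden in the sketch sizes: a random matrix embedding the column space of `X` with
distortion `ρ / (ρ + 1)`, a Gaussian embedding with
`m ≥ C (r + log (1 / δ)) (ρ + 1)² / ρ²` rows, or a sparse embedding with
`m ≥ C (r² / δ) (ρ + 1)² / ρ²` rows, where `r` is the rank of `X`. -/
def AdmissibleSketch {Ω : Type*} [MeasurableSpace Ω] (Pr : Measure Ω) {m n d : ℕ}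
    (C ρ δ : ℝ) (P : Ω → Matrix (Fin m) (Fin n) ℝ) (X : Matrix (Fin n) (Fin d) ℝ) : Prop :=
  IsRandomSubspaceEmbedding Pr (ρ / (ρ + 1)) δ P X ∨
  (IsGaussianSketch Pr P ∧
    C * (((X.rank : ℝ) + Real.log (1 / δ)) * ((ρ + 1) ^ 2 / ρ ^ 2)) ≤ (m : ℝ)) ∨
  (IsSparseSketch Pr P ∧
    C * ((X.rank : ℝ) ^ 2 / δ * ((ρ + 1) ^ 2 / ρ ^ 2)) ≤ (m : ℝ))

end SketchedLasso

end

/-!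
The error bound combines a deterministic analysis, valid as soon as the sketch embeds the column
space of `X` and the noise is nearly uncorrelated with the columns of `X`, with the fact that each
of these two events fails with small probability.

*Deterministic part.* Let `ε = ρ / (ρ + 1)` be the distortion of the embedding. Comparing the
optimality conditions of a step of Iterative SRO and of the Lasso shows that a step multiplies
`‖β - β*‖_X` by at most `ε / (1 - ε) = ρ` (`step_contraction`). At the last iterate the gradient of
the Lasso objective is `(Xᵀ X - (P X)ᵀ (P X)) (β N - β (N - 1))` up to a subgradient of the penalty,
and the number of iterations makes all coordinates of this vector at most `lam μ`
(`run_nearly_stationary`). The noise contributes `2 lam / c` more, so that the last iterate is a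
stationary point of the noiseless problem up to `lam (μ + 2 / c)` in each coordinate. The error
`w = β N - βbar` of such a point satisfies the cone condition `‖w_T‖₁ ≤ γ ‖w_S‖₁`, where `S` is the
support of `βbar` and `T` its complement. Let `v` be the restriction of `w` to `S` and the `k`
largest coordinates in `T`. Cutting the remaining coordinates into blocks of size `k` in decreasing
order (`IsTopBlock.tail_le`) bounds their norm and, through the sparse eigenvalue condition
(`two_mul_neg_dotProduct_mul_le`), their interaction with `v`; testing stationarity against `v`
then gives the bound (`l2norm_sub_le_of_nearly_stationary`).

*Probabilistic part.* The noise event is a union bound over sub-Gaussian tails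
(`measureReal_noise_correlation_le`). For Gaussian sketches, chi-squared concentration for a fixed
vector (`IsGaussianSketch.measureReal_distortion_le`) is extended to the column space by a net
argument (`exists_distortion_test_set`). For sparse sketches, the entries of the sketched Gram
matrix of an orthonormal basis have variance at most `2 / m`
(`mul_sum_sq_sum_collision_le`), and Markov's inequality applies to the Frobenius norm.
-/

namespace SketchedLasso

/-! ### Norms -/

section Norms

variable {ι : Type*} [Fintype ι]

theorem l2norm_nonneg (v : ι → ℝ) : 0 ≤ l2norm v := norm_nonneg _

theorem l2norm_sq (v : ι → ℝ) : l2norm v ^ 2 = v ⬝ᵥ v := by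
  simp [l2norm, EuclideanSpace.norm_sq_eq, dotProduct, ← sq]

theorem l2norm_sq_eq_sum (v : ι → ℝ) : l2norm v ^ 2 = ∑ i, v i ^ 2 := by
  simp [l2norm, EuclideanSpace.norm_sq_eq]

@[simp] theorem l2norm_zero : l2norm (0 : ι → ℝ) = 0 := by simp [l2norm]

theorem l2norm_add_le (v w : ι → ℝ) : l2norm (v + w) ≤ l2norm v + l2norm w := by
  simpa [l2norm] using norm_add_le (WithLp.toLp 2 v) (WithLp.toLp 2 w)

theorem l2norm_neg (v : ι → ℝ) : l2norm (-v) = l2norm v := by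
  simp [l2norm]

theorem l2norm_sub_le (v w : ι → ℝ) : l2norm (v - w) ≤ l2norm v + l2norm w := by
  simpa [l2norm] using norm_sub_le (WithLp.toLp 2 v) (WithLp.toLp 2 w)

theorem l2norm_smul (a : ℝ) (v : ι → ℝ) : l2norm (a • v) = |a| * l2norm v := by
  simp [l2norm, norm_smul]

theorem l2norm_eq_zero {v : ι → ℝ} : l2norm v = 0 ↔ v = 0 := by
  simp [l2norm]

theorem l2norm_sq_add_smul (v w : ι → ℝ) (t : ℝ) :
    l2norm (v + t • w) ^ 2 = l2norm v ^ 2 + 2 * t * (v ⬝ᵥ w) + t ^ 2 * l2norm w ^ 2 := by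
  simp only [l2norm_sq, dotProduct_add, add_dotProduct, smul_dotProduct, dotProduct_smul,
    smul_eq_mul, dotProduct_comm w v]
  ring

/-- Convexity of `‖·‖₁` along a segment. -/
theorem l1norm_segment_le (v w : ι → ℝ) {t : ℝ} (h0 : 0 ≤ t) (h1 : t ≤ 1) :
    l1norm (v + t • (w - v)) ≤ l1norm v + t * (l1norm w - l1norm v) := by
  have : l1norm v + t * (l1norm w - l1norm v) = ∑ i, ((1 - t) * |v i| + t * |w i|) := by
    simp only [l1norm, Finset.sum_add_distrib, ← Finset.mul_sum]; ring
  rw [this]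
  refine Finset.sum_le_sum fun i _ => ?_
  have e : (v + t • (w - v)) i = (1 - t) * v i + t * w i := by
    simp; ring
  rw [e]
  refine (abs_add_le _ _).trans ?_
  rw [abs_mul, abs_mul, abs_of_nonneg h0, abs_of_nonneg (by linarith : 0 ≤ 1 - t)]

end Norms

theorem l2norm_mulVec_le {n d : ℕ} (X : Matrix (Fin n) (Fin d) ℝ) (v : Fin d → ℝ) :
    l2norm (X *ᵥ v) ≤ opNorm2 X * l2norm v := by
  have h := Matrix.l2_opNorm_mulVec X (WithLp.toLp 2 v)
  simpa [l2norm, opNorm2] using h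

theorem l2norm_mulVec_single_le {n d : ℕ} (X : Matrix (Fin n) (Fin d) ℝ) (j : Fin d) :
    l2norm (X *ᵥ Pi.single j 1) ≤ opNorm2 X := by
  have h := l2norm_mulVec_le X (Pi.single j 1)
  have e : l2norm (Pi.single j (1 : ℝ) : Fin d → ℝ) = 1 := by
    have := l2norm_sq (Pi.single j (1 : ℝ) : Fin d → ℝ)
    simp at this
    rcases this with h | h
    · exact h
    · linarith [l2norm_nonneg (Pi.single j (1 : ℝ) : Fin d → ℝ)]
  simpa [e] using h

/-! ### First-order optimality conditions -/

theorem nonneg_of_forall_le_quadratic {A B : ℝ}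
    (h : ∀ t : ℝ, 0 < t → t ≤ 1 → 0 ≤ t * A + t ^ 2 * B) : 0 ≤ A := by
  by_contra! hA
  have hB : 0 < |B| + 1 := by positivity
  have hA1 : 0 < -A := by linarith
  set t := min 1 (-A / (2 * (|B| + 1))) with ht
  have ht0 : 0 < t := lt_min one_pos (by positivity)
  have h1 := h t ht0 (min_le_left _ _)
  have h2 : t * (2 * (|B| + 1)) ≤ -A := by
    rw [← le_div_iff₀ (by positivity)]; exact min_le_right _ _
  have h3 : 0 ≤ A + t * B := by
    by_contra! h4
    nlinarith
  nlinarith [le_abs_self B]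

/-- Variational inequality for the minimizer of a convex quadratic plus `lam ‖·‖₁`. -/
theorem quadratic_lasso_variational {m d : ℕ} (M : Matrix (Fin m) (Fin d) ℝ) (p : Fin m → ℝ)
    (q : Fin d → ℝ) {lam : ℝ} (hlam : 0 ≤ lam) {β : Fin d → ℝ}
    (hmin : ∀ β', 1 / 2 * l2norm (M *ᵥ β - p) ^ 2 - q ⬝ᵥ β + lam * l1norm β ≤
      1 / 2 * l2norm (M *ᵥ β' - p) ^ 2 - q ⬝ᵥ β' + lam * l1norm β') (β' : Fin d → ℝ) :
    0 ≤ (Mᵀ *ᵥ (M *ᵥ β - p) - q) ⬝ᵥ (β' - β) + lam * (l1norm β' - l1norm β) := by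
  refine nonneg_of_forall_le_quadratic (B := 1 / 2 * l2norm (M *ᵥ (β' - β)) ^ 2) ?_
  intro t ht0 ht1
  have h := hmin (β + t • (β' - β))
  have e : M *ᵥ (β + t • (β' - β)) - p = (M *ᵥ β - p) + t • (M *ᵥ (β' - β)) := by
    rw [Matrix.mulVec_add, Matrix.mulVec_smul]; abel
  have e2 : (Mᵀ *ᵥ (M *ᵥ β - p) - q) ⬝ᵥ (β' - β) =
      (M *ᵥ β - p) ⬝ᵥ (M *ᵥ (β' - β)) - q ⬝ᵥ (β' - β) := by
    rw [sub_dotProduct, Matrix.mulVec_transpose, ← Matrix.dotProduct_mulVec]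
  rw [e, l2norm_sq_add_smul, dotProduct_add, dotProduct_smul, smul_eq_mul] at h
  have h1 := mul_le_mul_of_nonneg_left (l1norm_segment_le β β' ht0.le ht1) hlam
  rw [e2]
  nlinarith

/-- The gradient `Xsᵀ Xs (β - b) - Xᵀ (y - X b)` of the smooth part of the step objective. -/
def stepGradient {m n d : ℕ} (X : Matrix (Fin n) (Fin d) ℝ) (Xs : Matrix (Fin m) (Fin d) ℝ)
    (y : Fin n → ℝ) (b β : Fin d → ℝ) : Fin d → ℝ :=
  Xsᵀ *ᵥ (Xs *ᵥ (β - b)) - Xᵀ *ᵥ (y - X *ᵥ b)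

theorem step_variational {m n d : ℕ} {X : Matrix (Fin n) (Fin d) ℝ}
    {Xs : Matrix (Fin m) (Fin d) ℝ} {y : Fin n → ℝ} {lam : ℝ} (hlam : 0 ≤ lam)
    {b β : Fin d → ℝ}
    (hmin : IsMinOn (stepObjective X Xs y (fun β => lam * l1norm β) b) Set.univ β)
    (β' : Fin d → ℝ) :
    0 ≤ stepGradient X Xs y b β ⬝ᵥ (β' - β) + lam * (l1norm β' - l1norm β) := by
  have h := quadratic_lasso_variational Xs (Xs *ᵥ b) (Xᵀ *ᵥ (y - X *ᵥ b)) hlam (β := β) ?_ β'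
  · simpa only [stepGradient, Matrix.mulVec_sub] using h
  · intro β'
    have := isMinOn_univ_iff.1 hmin β'
    simp only [stepObjective, Matrix.dotProduct_mulVec, Matrix.mulVec_sub] at this
    simpa only [Matrix.mulVec_transpose] using this

theorem lasso_variational {n d : ℕ} {X : Matrix (Fin n) (Fin d) ℝ}
    {y : Fin n → ℝ} {lam : ℝ} (hlam : 0 ≤ lam) {β : Fin d → ℝ}
    (hmin : IsMinOn (objective X y (fun β => lam * l1norm β)) Set.univ β)
    (β' : Fin d → ℝ) :
    0 ≤ (Xᵀ *ᵥ (X *ᵥ β - y)) ⬝ᵥ (β' - β) + lam * (l1norm β' - l1norm β) := by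
  have h := quadratic_lasso_variational X y 0 hlam (β := β) ?_ β'
  · simpa only [sub_zero] using h
  · intro β'
    have := isMinOn_univ_iff.1 hmin β'
    simp only [objective] at this
    rw [← l2norm_neg, neg_sub, ← l2norm_neg (y - X *ᵥ β'), neg_sub] at this
    simpa using this

theorem l1norm_add_single {d : ℕ} (β : Fin d → ℝ) (j : Fin d) (t : ℝ) :
    l1norm (β + Pi.single j t) - l1norm β = |β j + t| - |β j| := by
  rw [l1norm, l1norm, ← Finset.sum_sub_distrib, Finset.sum_eq_single j]
  · simp
  · intro i _ hi; simp [hi]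
  · simp

/-- Coordinatewise form of the optimality condition: `-g` belongs to the subdifferential of
`lam ‖·‖₁` at `β`. -/
theorem subgradient_of_variational {d : ℕ} {g β : Fin d → ℝ} {lam : ℝ}
    (h : ∀ β', 0 ≤ g ⬝ᵥ (β' - β) + lam * (l1norm β' - l1norm β)) (hlam : 0 ≤ lam) (j : Fin d) :
    |g j| ≤ lam ∧ g j * β j = -(lam * |β j|) := by
  have key : ∀ t : ℝ, 0 ≤ g j * t + lam * (|β j + t| - |β j|) := by
    intro t
    have := h (β + Pi.single j t)
    rw [l1norm_add_single] at this
    simpa using this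
  constructor
  · rw [abs_le]
    constructor
    · have h1 := key 1
      have := abs_add_le (β j) 1
      rw [abs_one] at this
      nlinarith
    · have h1 := key (-1)
      have := abs_add_le (β j) (-1)
      rw [abs_neg, abs_one] at this
      nlinarith
  · have h1 := key (-β j)
    have h2 := key (β j)
    have e : |β j + β j| = 2 * |β j| := by rw [← two_mul, abs_mul]; norm_num
    rw [e] at h2
    simp at h1
    linarith

/-! ### Contraction of Iterative SRO -/

/-- A subspace embedding nearly preserves the inner products on the column space. By polarization,
the difference of the inner products is a bilinear form whose quadratic form is at most `ε ‖·‖_X²`,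
and the bound is a discriminant inequality in the coefficient `t` of `u + t v`. -/
theorem IsSubspaceEmbedding.abs_dotProduct_sub_le {m n d : ℕ} {ε : ℝ}
    {P : Matrix (Fin m) (Fin n) ℝ} {X : Matrix (Fin n) (Fin d) ℝ}
    (h : IsSubspaceEmbedding ε P X) (hε : 0 ≤ ε) (u v : Fin d → ℝ) :
    |((P * X) *ᵥ u) ⬝ᵥ ((P * X) *ᵥ v) - (X *ᵥ u) ⬝ᵥ (X *ᵥ v)| ≤
      ε * (dataNorm X u * dataNorm X v) := by
  set B := ((P * X) *ᵥ u) ⬝ᵥ ((P * X) *ᵥ v) - (X *ᵥ u) ⬝ᵥ (X *ᵥ v) with hB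
  have hq : ∀ t : ℝ,
      0 ≤ (ε * dataNorm X v ^ 2) * (t * t) + (-(2 * B)) * t + ε * dataNorm X u ^ 2 := by
    intro t
    have h1 := (h (u + t • v)).2
    have h2 := (h (u + (-t) • v)).1
    simp only [Matrix.mulVec_add, Matrix.mulVec_smul, l2norm_sq_add_smul] at h1 h2
    simp only [Matrix.mulVec_mulVec] at h1 h2
    simp only [dataNorm]
    nlinarith
  have hd := discrim_le_zero hq
  rw [discrim] at hd
  have hn : 0 ≤ ε * (dataNorm X u * dataNorm X v) :=
    mul_nonneg hε (mul_nonneg (l2norm_nonneg _) (l2norm_nonneg _))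
  exact abs_le_of_sq_le_sq (by nlinarith) hn

/-- One step of Iterative SRO contracts the prediction distance to the Lasso solution. Adding the
two variational inequalities cancels the `ℓ¹` norms and leaves
`‖P X D‖² ≤ ⟨P X D, P X D₀⟩ - ⟨X D, X D₀⟩` for the new and old differences `D` and `D₀`; the
contraction factor is `ε / (1 - ε) = ρ` for `ε = ρ / (ρ + 1)`. -/
theorem step_contraction {m n d : ℕ} {X : Matrix (Fin n) (Fin d) ℝ}
    {P : Matrix (Fin m) (Fin n) ℝ} {y : Fin n → ℝ} {lam ρ : ℝ} (hlam : 0 ≤ lam) (hρ : 0 < ρ)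
    (hP : IsSubspaceEmbedding (ρ / (ρ + 1)) P X) {b β βstar : Fin d → ℝ}
    (hstar : IsMinOn (objective X y (fun β => lam * l1norm β)) Set.univ βstar)
    (hβ : IsMinOn (stepObjective X (P * X) y (fun β => lam * l1norm β) b) Set.univ β) :
    dataNorm X (β - βstar) ≤ ρ * dataNorm X (b - βstar) := by
  have h1 := lasso_variational hlam hstar β
  have h2 := step_variational hlam hβ βstar
  have hε : 0 ≤ ρ / (ρ + 1) := by positivity
  have hB := (abs_le.1 (hP.abs_dotProduct_sub_le hε (b - βstar) (β - βstar))).2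
  have hL := (hP (β - βstar)).1
  set D := β - βstar with hD
  set D0 := b - βstar with hD0
  have e1 : (Xᵀ *ᵥ (X *ᵥ βstar - y)) ⬝ᵥ D = (X *ᵥ βstar - y) ⬝ᵥ (X *ᵥ D) := by
    rw [Matrix.mulVec_transpose, ← Matrix.dotProduct_mulVec]
  have e2 : stepGradient X (P * X) y b β ⬝ᵥ (βstar - β) =
      -(((P * X) *ᵥ (D - D0)) ⬝ᵥ ((P * X) *ᵥ D) - (y - X *ᵥ βstar - X *ᵥ D0) ⬝ᵥ (X *ᵥ D)) := by
    have : βstar - β = -D := by simp [hD]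
    have e3 : β - b = D - D0 := by simp [hD, hD0]
    have e4 : y - X *ᵥ b = y - X *ᵥ βstar - X *ᵥ D0 := by
      rw [hD0, Matrix.mulVec_sub]; abel
    rw [this, dotProduct_neg, stepGradient, sub_dotProduct, Matrix.mulVec_transpose,
      Matrix.mulVec_transpose, ← Matrix.dotProduct_mulVec, ← Matrix.dotProduct_mulVec, e3, e4]
  rw [e1] at h1
  rw [e2, Matrix.mulVec_sub] at h2
  rw [Matrix.mulVec_mulVec, l2norm_sq ((P * X) *ᵥ D)] at hL
  simp only [sub_dotProduct] at h1 h2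
  have hmain : (1 - ρ / (ρ + 1)) * dataNorm X D ^ 2 ≤
      ρ / (ρ + 1) * (dataNorm X D0 * dataNorm X D) := by
    simp only [dataNorm] at hB ⊢
    linarith
  have e3 : (1 - ρ / (ρ + 1)) = 1 / (ρ + 1) := by field_simp; ring
  rw [e3, one_div, div_eq_inv_mul, mul_assoc, mul_le_mul_iff_right₀ (by positivity)] at hmain
  rcases (show 0 ≤ dataNorm X D from l2norm_nonneg _).eq_or_lt with h0 | h0
  · rw [← h0]; exact mul_nonneg hρ.le (l2norm_nonneg _)
  · nlinarith

/-- Geometric convergence of Iterative SRO, started at `0`, to the Lasso solution. -/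
theorem run_contraction {m n d : ℕ} {X : Matrix (Fin n) (Fin d) ℝ}
    {P : Matrix (Fin m) (Fin n) ℝ} {y : Fin n → ℝ} {lam ρ : ℝ} (hlam : 0 ≤ lam) (hρ : 0 < ρ)
    (hP : IsSubspaceEmbedding (ρ / (ρ + 1)) P X) {βstar : Fin d → ℝ}
    (hstar : IsMinOn (objective X y (fun β => lam * l1norm β)) Set.univ βstar)
    {N : ℕ} {β : ℕ → Fin d → ℝ}
    (hrun : IsIterativeSRORun X (P * X) y (fun β => lam * l1norm β) N β) {t : ℕ} (ht : t ≤ N) :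
    dataNorm X (β t - βstar) ≤ ρ ^ t * dataNorm X βstar := by
  induction t with
  | zero =>
    rw [hrun.1, zero_sub, dataNorm, dataNorm, Matrix.mulVec_neg, l2norm_neg]; simp
  | succ t ih =>
    have h := step_contraction hlam hρ hP hstar (hrun.2 (t + 1) (by omega) ht)
    rw [Nat.add_sub_cancel] at h
    refine h.trans ?_
    rw [pow_succ', mul_assoc]
    exact mul_le_mul_of_nonneg_left (ih (by omega)) hρ.le

/-- The number of iterations is chosen such that `ρ ^ N` compensates `‖X‖₂ ‖β*‖_X / (lam μ)`. -/
theorem pow_mul_le_of_iterationNumber_le {n d : ℕ} {X : Matrix (Fin n) (Fin d) ℝ}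
    {lam μ ρ : ℝ} (hlam : 0 < lam) (hμ : 0 < μ) (hρ : ρ ∈ Set.Ioo (0 : ℝ) 1)
    {βstar : Fin d → ℝ} {N : ℕ} (hN : iterationNumber X lam μ ρ βstar ≤ N) :
    ρ ^ N * (opNorm2 X * dataNorm X βstar) ≤ lam * μ := by
  have hop : 0 ≤ opNorm2 X :=
    @norm_nonneg _ (Matrix.instL2OpNormedAddCommGroup
      (𝕜 := ℝ)).toSeminormedAddCommGroup.toSeminormedAddGroup X
  have hx : 0 ≤ opNorm2 X * dataNorm X βstar := mul_nonneg hop (l2norm_nonneg _)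
  rcases hx.eq_or_lt with h0 | h0
  · rw [← h0, mul_zero]; positivity
  set x := opNorm2 X * dataNorm X βstar with hxdef
  have hlog : 0 < Real.log (1 / ρ) := Real.log_pos (by rw [lt_div_iff₀ hρ.1]; linarith [hρ.2])
  have h1 : Real.log (x / (lam * μ)) / Real.log (1 / ρ) < N := by
    refine (Nat.lt_floor_add_one _).trans_le ?_
    have : ((⌊Real.log (x / (lam * μ)) / Real.log (1 / ρ)⌋₊ + 1 : ℕ) : ℝ) ≤ N := by
      rw [add_comm]; exact_mod_cast hN
    exact_mod_cast this
  rw [div_lt_iff₀ hlog, one_div, Real.log_inv] at h1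
  have h2 : Real.log (ρ ^ N * (x / (lam * μ))) ≤ 0 := by
    rw [Real.log_mul (pow_pos hρ.1 _).ne' (by positivity), Real.log_pow]
    linarith
  have h3 : ρ ^ N * (x / (lam * μ)) ≤ 1 := by
    rwa [Real.log_nonpos_iff (mul_nonneg (pow_pos hρ.1 _).le (by positivity))] at h2
  rw [mul_div_assoc', div_le_one (by positivity)] at h3
  exact h3

/-- The last iterate is a nearly stationary point of the Lasso objective: there is `g` with `-g` in
the subdifferential of `lam ‖·‖₁` at `β N` from which the gradient of the quadratic part differs by
at most `lam μ` in every coordinate. The vector `g` is the gradient of the last step objective; the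
difference is `(Xᵀ X - (P X)ᵀ (P X)) (β N - β (N - 1))`, which the embedding property bounds. -/
theorem run_nearly_stationary {m n d : ℕ} {X : Matrix (Fin n) (Fin d) ℝ}
    {P : Matrix (Fin m) (Fin n) ℝ} {y : Fin n → ℝ} {lam ρ μ : ℝ} (hlam : 0 < lam) (hμ : 0 < μ)
    (hρ : ρ ∈ Set.Ioo (0 : ℝ) 1) (hP : IsSubspaceEmbedding (ρ / (ρ + 1)) P X) {βstar : Fin d → ℝ}
    (hstar : IsMinOn (objective X y (fun β => lam * l1norm β)) Set.univ βstar)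
    {N : ℕ} (hN : iterationNumber X lam μ ρ βstar ≤ N) {β : ℕ → Fin d → ℝ}
    (hrun : IsIterativeSRORun X (P * X) y (fun β => lam * l1norm β) N β) :
    ∃ g : Fin d → ℝ, (∀ j, |g j| ≤ lam ∧ g j * β N j = -(lam * |β N j|)) ∧
      ∀ j, |(Xᵀ *ᵥ (X *ᵥ β N - y)) j - g j| ≤ lam * μ := by
  have hN1 : 1 ≤ N := le_trans (by simp [iterationNumber]) hN
  refine ⟨stepGradient X (P * X) y (β (N - 1)) (β N), fun j =>
    subgradient_of_variational (step_variational hlam.le (hrun.2 N hN1 le_rfl)) hlam.le j,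
    fun j => ?_⟩
  set u := β N - β (N - 1) with hu
  set e : Fin d → ℝ := Pi.single j 1
  have he : (Xᵀ *ᵥ (X *ᵥ β N - y)) j - stepGradient X (P * X) y (β (N - 1)) (β N) j =
      -(((P * X) *ᵥ u) ⬝ᵥ ((P * X) *ᵥ e) - (X *ᵥ u) ⬝ᵥ (X *ᵥ e)) := by
    have h1 : ∀ {p : ℕ} (M : Matrix (Fin p) (Fin d) ℝ) (w : Fin p → ℝ),
        (Mᵀ *ᵥ w) j = w ⬝ᵥ (M *ᵥ e) := by
      intro p M w
      rw [Matrix.dotProduct_mulVec, ← Matrix.mulVec_transpose]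
      simp [e]
    rw [stepGradient, Pi.sub_apply, h1, h1, h1, hu, Matrix.mulVec_sub X]
    simp only [sub_dotProduct]
    ring
  have hε : 0 ≤ ρ / (ρ + 1) := by have := hρ.1; positivity
  rw [he, abs_neg]
  refine (hP.abs_dotProduct_sub_le hε u e).trans ?_
  have hu1 : dataNorm X u ≤ (ρ + 1) * (ρ ^ (N - 1) * dataNorm X βstar) := by
    have e1 : X *ᵥ u = X *ᵥ (β N - βstar) - X *ᵥ (β (N - 1) - βstar) := by
      rw [← Matrix.mulVec_sub, hu]; congr 1; abel
    rw [dataNorm, e1]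
    refine (l2norm_sub_le _ _).trans ?_
    have h1 := run_contraction hlam.le hρ.1 hP hstar hrun (le_refl N)
    have h2 := run_contraction hlam.le hρ.1 hP hstar hrun (Nat.sub_le N 1)
    have h3 : ρ ^ N = ρ * ρ ^ (N - 1) := by rw [← pow_succ', Nat.sub_add_cancel hN1]
    rw [h3] at h1
    simp only [dataNorm] at h1 h2 ⊢
    linarith
  have h4 : dataNorm X e ≤ opNorm2 X := l2norm_mulVec_single_le X j
  have hρ1 := hρ.1
  calc ρ / (ρ + 1) * (dataNorm X u * dataNorm X e)
      ≤ ρ / (ρ + 1) * (((ρ + 1) * (ρ ^ (N - 1) * dataNorm X βstar)) * opNorm2 X) := by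
        refine mul_le_mul_of_nonneg_left ?_ hε
        exact mul_le_mul hu1 h4 (l2norm_nonneg _) (le_trans (l2norm_nonneg _) hu1)
    _ = ρ ^ N * (opNorm2 X * dataNorm X βstar) := by
        have h3 : ρ ^ N = ρ * ρ ^ (N - 1) := by rw [← pow_succ', Nat.sub_add_cancel hN1]
        rw [h3]; field_simp
    _ ≤ lam * μ := pow_mul_le_of_iterationNumber_le hlam hμ hρ hN

/-! ### Sparse eigenvalues -/

theorem dotProduct_gram {n d : ℕ} (X : Matrix (Fin n) (Fin d) ℝ) (v w : Fin d → ℝ) :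
    v ⬝ᵥ ((Xᵀ * X) *ᵥ w) = (X *ᵥ v) ⬝ᵥ (X *ᵥ w) := by
  rw [← Matrix.mulVec_mulVec, Matrix.dotProduct_mulVec, Matrix.vecMul_transpose]

theorem hammingNorm_le_card {d : ℕ} {v : Fin d → ℝ} {A : Finset (Fin d)}
    (h : ∀ i, i ∉ A → v i = 0) : hammingNorm v ≤ A.card := by
  refine Finset.card_le_card fun i hi => ?_
  by_contra hA
  simp [h i hA] at hi

theorem sparseEigMin_mul_sq_le {n d : ℕ} (X : Matrix (Fin n) (Fin d) ℝ) {s : ℕ} {v : Fin d → ℝ}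
    (hv : hammingNorm v ≤ s) : sparseEigMin X s * l2norm v ^ 2 ≤ l2norm (X *ᵥ v) ^ 2 := by
  rcases (l2norm_nonneg v).eq_or_lt with h0 | h0
  · rw [← h0]; simp; positivity
  have h1 : sparseEigMin X s ≤ (l2norm v)⁻¹ ^ 2 * l2norm (X *ᵥ v) ^ 2 := by
    refine csInf_le ⟨0, ?_⟩ ⟨(l2norm v)⁻¹ • v, ?_, ?_, ?_⟩
    · rintro r ⟨w, -, -, rfl⟩
      rw [dotProduct_gram, ← l2norm_sq]; positivity
    · rwa [hammingNorm_smul fun _ => .of_ne_zero (inv_ne_zero h0.ne')]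
    · rw [l2norm_smul, abs_of_pos (inv_pos.2 h0), inv_mul_cancel₀ h0.ne']
    · rw [dotProduct_gram, ← l2norm_sq, Matrix.mulVec_smul, l2norm_smul, mul_pow, sq_abs]
  calc _ ≤ ((l2norm v)⁻¹ ^ 2 * l2norm (X *ᵥ v) ^ 2) * l2norm v ^ 2 := by gcongr
    _ = _ := by field_simp

theorem sq_le_sparseEigMax_mul {n d : ℕ} (X : Matrix (Fin n) (Fin d) ℝ) {s : ℕ} {v : Fin d → ℝ}
    (hv : hammingNorm v ≤ s) : l2norm (X *ᵥ v) ^ 2 ≤ sparseEigMax X s * l2norm v ^ 2 := by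
  rcases (l2norm_nonneg v).eq_or_lt with h0 | h0
  · have : v = 0 := l2norm_eq_zero.1 h0.symm
    simp [this]
  have h1 : (l2norm v)⁻¹ ^ 2 * l2norm (X *ᵥ v) ^ 2 ≤ sparseEigMax X s := by
    refine le_csSup ⟨opNorm2 X ^ 2, ?_⟩ ⟨(l2norm v)⁻¹ • v, ?_, ?_, ?_⟩
    · rintro r ⟨w, -, hw, rfl⟩
      rw [dotProduct_gram, ← l2norm_sq]
      have := l2norm_mulVec_le X w
      rw [hw, mul_one] at this
      exact pow_le_pow_left₀ (l2norm_nonneg _) this 2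
    · rwa [hammingNorm_smul fun _ => .of_ne_zero (inv_ne_zero h0.ne')]
    · rw [l2norm_smul, abs_of_pos (inv_pos.2 h0), inv_mul_cancel₀ h0.ne']
    · rw [dotProduct_gram, ← l2norm_sq, Matrix.mulVec_smul, l2norm_smul, mul_pow, sq_abs]
  calc l2norm (X *ᵥ v) ^ 2 = ((l2norm v)⁻¹ ^ 2 * l2norm (X *ᵥ v) ^ 2) * l2norm v ^ 2 := by
        field_simp
    _ ≤ _ := by gcongr

theorem sparseEigMin_anti {n d : ℕ} (X : Matrix (Fin n) (Fin d) ℝ) {s t : ℕ} (hd : 0 < d)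
    (hs : 1 ≤ s) (hst : s ≤ t) : sparseEigMin X t ≤ sparseEigMin X s := by
  refine csInf_le_csInf ⟨0, ?_⟩ ?_ ?_
  · rintro r ⟨w, -, -, rfl⟩
    rw [dotProduct_gram, ← l2norm_sq]; positivity
  · refine ⟨_, Pi.single ⟨0, hd⟩ 1, ?_, ?_, rfl⟩
    · refine (hammingNorm_le_card (A := {⟨0, hd⟩}) fun i hi => ?_).trans (by simpa using hs)
      simp at hi
      simp [hi]
    · simp [l2norm]
  · rintro r ⟨v, h1, h2, h3⟩
    exact ⟨v, h1.trans hst, h2, h3⟩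

/-! ### Coordinate restrictions and blocks of large coordinates -/

/-- The vector `w` with all coordinates outside `A` set to zero. -/
def restrict {d : ℕ} (A : Finset (Fin d)) (w : Fin d → ℝ) : Fin d → ℝ :=
  fun i => if i ∈ A then w i else 0

theorem restrict_union {d : ℕ} {A B : Finset (Fin d)} (h : Disjoint A B) (w : Fin d → ℝ) :
    restrict (A ∪ B) w = restrict A w + restrict B w := by
  ext i
  simp only [restrict, Finset.mem_union, Pi.add_apply]
  by_cases hA : i ∈ A
  · simp [hA, Finset.disjoint_left.1 h hA]
  · simp [hA]

theorem restrict_dotProduct {d : ℕ} (A : Finset (Fin d)) (w h : Fin d → ℝ) :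
    restrict A w ⬝ᵥ h = ∑ i ∈ A, w i * h i := by
  simp [restrict, dotProduct, ite_mul]

theorem l2norm_restrict_sq {d : ℕ} (A : Finset (Fin d)) (w : Fin d → ℝ) :
    l2norm (restrict A w) ^ 2 = ∑ i ∈ A, w i ^ 2 := by
  rw [l2norm_sq, restrict_dotProduct]
  refine Finset.sum_congr rfl fun i hi => ?_
  simp [restrict, hi, sq]

theorem restrict_dotProduct_restrict {d : ℕ} {A B : Finset (Fin d)} (h : Disjoint A B)
    (w : Fin d → ℝ) : restrict A w ⬝ᵥ restrict B w = 0 := by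
  rw [restrict_dotProduct]
  refine Finset.sum_eq_zero fun i hi => ?_
  simp [restrict, Finset.disjoint_left.1 h hi]

theorem sum_abs_le_sqrt_card_mul {d : ℕ} (A : Finset (Fin d)) (w : Fin d → ℝ) :
    ∑ i ∈ A, |w i| ≤ √(A.card : ℝ) * l2norm (restrict A w) := by
  refine le_of_sq_le_sq ?_ (mul_nonneg (Real.sqrt_nonneg _) (l2norm_nonneg _))
  rw [mul_pow, Real.sq_sqrt (by positivity), l2norm_restrict_sq]
  have := sq_sum_le_card_mul_sum_sq (s := A) (f := fun i => |w i|)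
  simpa only [sq_abs] using this

/-- `J` consists of the `k` coordinates in `T` at which `|w|` is largest, or of all of `T` if there
are at most `k` of them. -/
structure IsTopBlock {d : ℕ} (w : Fin d → ℝ) (k : ℕ) (T J : Finset (Fin d)) : Prop where
  subset : J ⊆ T
  card_le : J.card ≤ k
  full : J.card = k ∨ J = T
  le : ∀ i ∈ J, ∀ j ∈ T \ J, |w j| ≤ |w i|

theorem exists_isTopBlock {d : ℕ} (w : Fin d → ℝ) (k : ℕ) (T : Finset (Fin d)) :
    ∃ J, IsTopBlock w k T J := by
  induction k with
  | zero => exact ⟨∅, by simp, by simp, by simp, by simp⟩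
  | succ k ih =>
    obtain ⟨J, hJ⟩ := ih
    by_cases hT : J = T
    · exact ⟨J, hJ.subset, hJ.card_le.trans (by omega), Or.inr hT, hJ.le⟩
    have hc : J.card = k := hJ.full.resolve_right hT
    have hne : (T \ J).Nonempty := by
      rw [Finset.sdiff_nonempty]
      exact fun h => hT (hJ.subset.antisymm h)
    obtain ⟨x, hx, hmax⟩ := Finset.exists_max_image (T \ J) (fun i => |w i|) hne
    have hx' := Finset.mem_sdiff.1 hx
    refine ⟨insert x J, Finset.insert_subset hx'.1 hJ.subset, ?_, Or.inl ?_, ?_⟩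
    · rw [Finset.card_insert_of_notMem hx'.2, hc]
    · rw [Finset.card_insert_of_notMem hx'.2, hc]
    · intro i hi j hj
      have hj' : j ∈ T \ J := by
        simp only [Finset.mem_sdiff, Finset.mem_insert, not_or] at hj ⊢
        exact ⟨hj.1, hj.2.2⟩
      rcases Finset.mem_insert.1 hi with rfl | hi
      · exact hmax j hj'
      · exact hJ.le i hi j hj'

/-- Cutting the coordinates outside the top block into further blocks of size `k` in decreasing
order, the Euclidean norm of every block is at most `k ^ (-1/2)` times the `ℓ¹` norm of the
preceding one. Hence a subadditive functional controlled by `K ‖·‖₂` on `k`-sparse restrictions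
is controlled by `K ‖w_T‖₁ / √k` on the whole tail. -/
theorem IsTopBlock.tail_le {d : ℕ} {w : Fin d → ℝ} {k : ℕ} (hk : 0 < k)
    {φ : (Fin d → ℝ) → ℝ} (hφ0 : φ 0 ≤ 0) (hφ : ∀ u v, φ (u + v) ≤ φ u + φ v) {K : ℝ} (hK : 0 ≤ K)
    {T J : Finset (Fin d)} (hJ : IsTopBlock w k T J)
    (hb : ∀ B ⊆ T \ J, B.card ≤ k → φ (restrict B w) ≤ K * l2norm (restrict B w)) :
    φ (restrict (T \ J) w) ≤ K * ((∑ i ∈ T, |w i|) / √(k : ℝ)) := by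
  induction hn : T.card using Nat.strong_induction_on generalizing T J with
  | _ n ih =>
  have hk' : (0 : ℝ) < √(k : ℝ) := Real.sqrt_pos.2 (by exact_mod_cast hk)
  have hnn : ∀ A : Finset (Fin d), 0 ≤ ∑ i ∈ A, |w i| :=
    fun A => Finset.sum_nonneg fun _ _ => abs_nonneg _
  rcases hJ.full with hc | rfl
  swap
  · have : restrict (J \ J) w = 0 := by ext i; simp [restrict]
    rw [this]
    exact hφ0.trans (mul_nonneg hK (div_nonneg (hnn J) hk'.le))
  obtain ⟨B, hB⟩ := exists_isTopBlock w k (T \ J)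
  have hlt : (T \ J).card < n := by
    rw [← hn]
    refine Finset.card_lt_card ⟨Finset.sdiff_subset, fun h => ?_⟩
    obtain ⟨x, hx⟩ : J.Nonempty := by rw [← Finset.card_pos]; omega
    exact (Finset.mem_sdiff.1 (h (hJ.subset hx))).2 hx
  have h1 := ih _ hlt hB
    (fun A hA => hb A (hA.trans Finset.sdiff_subset)) rfl
  have h2 := hb B hB.subset hB.card_le
  -- every coordinate in `B` is at most the average of `|w|` over `J`
  have h3 : l2norm (restrict B w) ≤ (∑ i ∈ J, |w i|) / √(k : ℝ) := by
    have h4 : ∀ j ∈ B, |w j| ≤ (∑ i ∈ J, |w i|) / k := by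
      intro j hj
      rw [le_div_iff₀ (by exact_mod_cast hk), mul_comm, ← hc, ← nsmul_eq_mul]
      exact Finset.card_nsmul_le_sum _ _ _ fun i hi => hJ.le i hi j (hB.subset hj)
    refine le_of_sq_le_sq ?_ (div_nonneg (hnn J) hk'.le)
    rw [l2norm_restrict_sq, div_pow, Real.sq_sqrt (by positivity)]
    calc ∑ i ∈ B, w i ^ 2 ≤ ∑ i ∈ B, ((∑ i ∈ J, |w i|) / k) ^ 2 := by
          refine Finset.sum_le_sum fun i hi => ?_
          rw [← sq_abs]
          exact pow_le_pow_left₀ (abs_nonneg _) (h4 i hi) 2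
      _ = B.card * ((∑ i ∈ J, |w i|) / k) ^ 2 := by rw [Finset.sum_const, nsmul_eq_mul]
      _ ≤ k * ((∑ i ∈ J, |w i|) / k) ^ 2 := by
          have : (B.card : ℝ) ≤ k := by exact_mod_cast hB.card_le
          gcongr
      _ = _ := by
          have : (k : ℝ) ≠ 0 := by exact_mod_cast hk.ne'
          field_simp
  have e : restrict (T \ J) w = restrict B w + restrict ((T \ J) \ B) w := by
    rw [← restrict_union Finset.disjoint_sdiff, Finset.union_sdiff_of_subset hB.subset]
  have hsum : ∑ i ∈ T, |w i| = ∑ i ∈ J, |w i| + ∑ i ∈ T \ J, |w i| := by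
    rw [add_comm, Finset.sum_sdiff hJ.subset]
  rw [e, hsum, add_div, mul_add]
  exact (hφ _ _).trans (add_le_add (h2.trans (mul_le_mul_of_nonneg_left h3 hK)) h1)

/-- Orthogonal vectors `v` and `u` are nearly orthogonal in the geometry of `X` if the eigenvalues
of `Xᵀ X` on their span are controlled: `‖X (v + t u)‖² - r ‖v + t u‖²` is a nonnegative quadratic
polynomial in `t`, and its discriminant bounds `⟨X v, X u⟩`. -/
theorem two_mul_neg_dotProduct_mul_le {n d : ℕ} {X : Matrix (Fin n) (Fin d) ℝ} {v u : Fin d → ℝ}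
    {r η : ℝ} (hη : 0 ≤ η) (huv : v ⬝ᵥ u = 0)
    (hlow : ∀ t : ℝ, r * l2norm (v + t • u) ^ 2 ≤ l2norm (X *ᵥ (v + t • u)) ^ 2)
    (hupp : l2norm (X *ᵥ u) ^ 2 ≤ r * (1 + η) * l2norm u ^ 2) :
    2 * (-((X *ᵥ v) ⬝ᵥ (X *ᵥ u)) * l2norm v) ≤ l2norm (X *ᵥ v) ^ 2 * √η * l2norm u := by
  set q := l2norm (X *ᵥ v) ^ 2 with hq
  set B := (X *ᵥ v) ⬝ᵥ (X *ᵥ u) with hB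
  have hquad : ∀ t : ℝ,
      0 ≤ (r * η * l2norm u ^ 2) * (t * t) + (2 * B) * t + (q - r * l2norm v ^ 2) := by
    intro t
    have h1 := hlow t
    rw [Matrix.mulVec_add, Matrix.mulVec_smul, l2norm_sq_add_smul, l2norm_sq_add_smul, huv] at h1
    nlinarith [mul_le_mul_of_nonneg_left hupp (sq_nonneg t)]
  have hd := discrim_le_zero hquad
  rw [discrim] at hd
  have hq0 : 0 ≤ q := by positivity
  refine (le_abs_self _).trans (abs_le_of_sq_le_sq ?_
    (mul_nonneg (mul_nonneg hq0 (Real.sqrt_nonneg _)) (l2norm_nonneg _)))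
  rw [mul_pow (q * √η), mul_pow q, Real.sq_sqrt hη]
  have h2 : (2 * (-B * l2norm v)) ^ 2 ≤
      4 * ((q - r * l2norm v ^ 2) * (r * l2norm v ^ 2)) * (η * l2norm u ^ 2) := by
    nlinarith [mul_le_mul_of_nonneg_right hd (sq_nonneg (l2norm v))]
  -- AM-GM for `q = (q - r ‖v‖²) + r ‖v‖²`
  have h3 : 4 * ((q - r * l2norm v ^ 2) * (r * l2norm v ^ 2)) ≤ q ^ 2 := by
    nlinarith [sq_nonneg (q - 2 * (r * l2norm v ^ 2))]
  have h4 : 0 ≤ η * l2norm u ^ 2 := by positivity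
  calc _ ≤ _ := h2
    _ ≤ q ^ 2 * (η * l2norm u ^ 2) := mul_le_mul_of_nonneg_right h3 h4
    _ = _ := by ring

/-! ### Estimation error of a nearly stationary point -/

/-- Coordinatewise source of the cone condition, with `h` the gradient `Xᵀ X (β - βbar)`: products
of error and gradient are bounded above in all coordinates, and they are negative, of the order of the
error, outside the support of the true parameter. -/
theorem cone_of_nearly_stationary {d : ℕ} {βbar β g h : Fin d → ℝ} {lam τ : ℝ}
    (hg : ∀ j, |g j| ≤ lam ∧ g j * β j = -(lam * |β j|))
    (hgrad : ∀ j, |h j - g j| ≤ lam * τ) (j : Fin d) :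
    (β j - βbar j) * h j ≤ lam * (1 + τ) * |β j - βbar j| ∧
      (βbar j = 0 → (β j - βbar j) * h j ≤ -(lam * (1 - τ) * |β j - βbar j|)) := by
  have h1 : (β j - βbar j) * (h j - g j) ≤ |β j - βbar j| * (lam * τ) := by
    refine (le_abs_self _).trans ?_
    rw [abs_mul]
    exact mul_le_mul_of_nonneg_left (hgrad j) (abs_nonneg _)
  have h2 : (β j - βbar j) * g j ≤ |β j - βbar j| * lam := by
    refine (le_abs_self _).trans ?_
    rw [abs_mul]
    exact mul_le_mul_of_nonneg_left (hg j).1 (abs_nonneg _)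
  refine ⟨by nlinarith, fun h0 => ?_⟩
  have h3 := (hg j).2
  rw [h0, sub_zero] at h1 ⊢
  nlinarith

/-- Estimation error of a nearly stationary point of the Lasso objective. The error `w` is split
into its restriction `v` to the support of `βbar` together with the top block of `k` coordinates off
the support, and the tail `u`. By the cone condition `u` is dominated by `v`, both in norm and in
its interaction with `v`, so that testing the stationarity condition against `v` bounds `‖v‖₂`. -/
theorem l2norm_sub_le_of_nearly_stationary {n d : ℕ} {X : Matrix (Fin n) (Fin d) ℝ}
    {βbar β g : Fin d → ℝ} {lam τ : ℝ} {k : ℕ}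
    (hk : SparseEigenvalueCondition X (hammingNorm βbar) k) (hd : 0 < d) (hlam : 0 < lam)
    (hτ0 : 0 ≤ τ) (hτ1 : τ < 1) (hγ : (1 + τ) / (1 - τ) * √(0.5 : ℝ) < 1)
    (hg : ∀ j, |g j| ≤ lam ∧ g j * β j = -(lam * |β j|))
    (hgrad : ∀ j, |(Xᵀ *ᵥ (X *ᵥ (β - βbar))) j - g j| ≤ lam * τ) :
    l2norm (β - βbar) ≤ lam * (1 + τ) /
      (sparseEigMin X (hammingNorm βbar + k) * (1 - (1 + τ) / (1 - τ) * √(0.5 : ℝ))) *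
        √(hammingNorm βbar : ℝ) := by
  classical
  set s := hammingNorm βbar with hs
  set γ := (1 + τ) / (1 - τ) with hγdef
  set w := β - βbar with hw
  set h := Xᵀ *ᵥ (X *ᵥ w) with hh
  set S : Finset (Fin d) := {i | βbar i ≠ 0} with hS
  have hScard : S.card = s := rfl
  set T := Sᶜ with hT
  have hτ : 0 < 1 - τ := by linarith
  have hγ0 : 0 < γ := by positivity
  have hcone := fun j => cone_of_nearly_stationary (βbar := βbar) hg hgrad j
  have hsumS : ∀ A ⊆ S, ∑ i ∈ A, w i * h i ≤ lam * (1 + τ) * ∑ i ∈ A, |w i| := by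
    intro A _
    rw [Finset.mul_sum]
    exact Finset.sum_le_sum fun i _ => (hcone i).1
  have hsumT : ∀ A ⊆ T, ∑ i ∈ A, w i * h i ≤ -(lam * (1 - τ) * ∑ i ∈ A, |w i|) := by
    intro A hA
    rw [Finset.mul_sum, ← Finset.sum_neg_distrib]
    refine Finset.sum_le_sum fun i hi => (hcone i).2 ?_
    have := hA hi
    simpa [hT, hS] using this
  -- the cone condition
  have hb : ∑ i ∈ T, |w i| ≤ γ * ∑ i ∈ S, |w i| := by
    have h1 : 0 ≤ ∑ i, w i * h i := by
      have : ∑ i, w i * h i = l2norm (X *ᵥ w) ^ 2 := by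
        rw [l2norm_sq, ← dotProduct_gram, ← Matrix.mulVec_mulVec]; rfl
      rw [this]; positivity
    rw [← Finset.sum_add_sum_compl S] at h1
    have h2 := hsumS S subset_rfl
    have h3 := hsumT T subset_rfl
    have h4 : lam * ((1 - τ) * ∑ i ∈ T, |w i|) ≤ lam * ((1 + τ) * ∑ i ∈ S, |w i|) := by linarith
    rw [mul_le_mul_iff_right₀ hlam] at h4
    rw [hγdef, div_mul_eq_mul_div, le_div_iff₀ hτ]
    linarith
  rcases Nat.eq_zero_or_pos s with hs0 | hs0
  -- if `βbar = 0`, the cone condition forces `w = 0`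
  · have hS0 : S = ∅ := by rw [← Finset.card_eq_zero, hScard, hs0]
    have hT0 : ∑ i ∈ T, |w i| = 0 := by
      refine le_antisymm ?_ (Finset.sum_nonneg fun _ _ => abs_nonneg _)
      simpa [hS0] using hb
    have hw0 : w = 0 := by
      ext i
      rw [Finset.sum_eq_zero_iff_of_nonneg (fun _ _ => abs_nonneg _)] at hT0
      simpa using hT0 i (by simp [hT, hS0])
    rw [hw0, l2norm_zero, hs0]
    simp
  have hk1 : 0 < k := by have := hk.two_mul_le; omega
  have hsR : (0 : ℝ) < s := by exact_mod_cast hs0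
  have hkR : (0 : ℝ) < k := by exact_mod_cast hk1
  have hr0 := hk.sparseEigMin_pos
  set r := sparseEigMin X (2 * k + s) with hr
  set ρ := sparseEigMin X (s + k) with hρ
  have hρ0 : 0 < ρ := hr0.trans_le (sparseEigMin_anti X hd (by omega) (by omega))
  obtain ⟨J, hJ⟩ := exists_isTopBlock w k T
  have hSJ : Disjoint S J := disjoint_compl_right.mono_right hJ.subset
  set v := restrict (S ∪ J) w with hv
  set u := restrict (T \ J) w with hu
  have hIu : Disjoint (S ∪ J) (T \ J) := by
    rw [Finset.disjoint_union_left]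
    exact ⟨disjoint_compl_right.mono_right Finset.sdiff_subset, Finset.disjoint_sdiff⟩
  have hwvu : w = v + u := by
    rw [hv, hu, ← restrict_union hIu, Finset.union_assoc, Finset.union_sdiff_of_subset hJ.subset]
    ext i; simp [restrict, hT]
  have hcardI : (S ∪ J).card ≤ s + k :=
    (Finset.card_union_le _ _).trans (add_le_add hScard.le hJ.card_le)
  have hvham : hammingNorm v ≤ s + k :=
    (hammingNorm_le_card (A := S ∪ J) fun i hi => by simp only [hv, restrict, if_neg hi]).trans
      hcardI
  -- the `ℓ¹` norm on the support is controlled by `‖v‖₂`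
  have hSv : ∑ i ∈ S, |w i| ≤ √(s : ℝ) * l2norm v := by
    have h1 := sum_abs_le_sqrt_card_mul S w
    rw [hScard] at h1
    refine h1.trans (mul_le_mul_of_nonneg_left ?_ (Real.sqrt_nonneg _))
    refine le_of_sq_le_sq ?_ (l2norm_nonneg _)
    rw [l2norm_restrict_sq, l2norm_restrict_sq]
    exact Finset.sum_le_sum_of_subset_of_nonneg Finset.subset_union_left
      fun _ _ _ => sq_nonneg _
  have hbv : ∑ i ∈ T, |w i| ≤ γ * (√(s : ℝ) * l2norm v) :=
    hb.trans (mul_le_mul_of_nonneg_left hSv hγ0.le)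
  set a := γ * √(0.5 : ℝ) with ha
  have ha0 : 0 ≤ a := by positivity
  -- size of the tail
  have hub : l2norm u ≤ a * l2norm v := by
    have h1 := hJ.tail_le hk1 (φ := l2norm) (by simp) l2norm_add_le zero_le_one
      (fun B _ _ => by rw [one_mul])
    rw [one_mul] at h1
    refine h1.trans ?_
    rw [div_le_iff₀ (Real.sqrt_pos.2 hkR)]
    refine hbv.trans ?_
    have h2 : √(s : ℝ) ≤ √(0.5 : ℝ) * √(k : ℝ) := by
      rw [← Real.sqrt_mul (by norm_num)]
      refine Real.sqrt_le_sqrt ?_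
      have : (2 * s : ℝ) ≤ k := by exact_mod_cast hk.two_mul_le
      linarith
    have h3 : 0 ≤ γ * l2norm v := mul_nonneg hγ0.le (l2norm_nonneg _)
    calc γ * (√(s : ℝ) * l2norm v) = √(s : ℝ) * (γ * l2norm v) := by ring
      _ ≤ √(0.5 : ℝ) * √(k : ℝ) * (γ * l2norm v) := mul_le_mul_of_nonneg_right h2 h3
      _ = a * l2norm v * √(k : ℝ) := by rw [ha]; ring
  -- interaction of `v` with the tail
  have hcross : 2 * (-((X *ᵥ v) ⬝ᵥ (X *ᵥ u)) * l2norm v) ≤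
      l2norm (X *ᵥ v) ^ 2 * (a * l2norm v) := by
    set η : ℝ := 0.5 * k / s with hη
    have hη0 : 0 ≤ η := by positivity
    have hratio := hk.ratio_le hs0
    rw [div_le_iff₀ hr0] at hratio
    have h1 := hJ.tail_le hk1
      (φ := fun z => 2 * (-((X *ᵥ v) ⬝ᵥ (X *ᵥ z)) * l2norm v)) (by simp)
      (fun z z' => by rw [Matrix.mulVec_add, dotProduct_add]; apply le_of_eq; ring)
      (K := l2norm (X *ᵥ v) ^ 2 * √η) (by positivity) (fun B hB hBk => ?_)
    · refine h1.trans ?_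
      rw [mul_assoc]
      refine mul_le_mul_of_nonneg_left ?_ (by positivity)
      calc √η * ((∑ i ∈ T, |w i|) / √(k : ℝ))
          ≤ √η * (γ * (√(s : ℝ) * l2norm v) / √(k : ℝ)) := by gcongr
        _ = a * l2norm v := by
          have h2 : √η = √(0.5 : ℝ) * √(k : ℝ) / √(s : ℝ) := by
            rw [hη, Real.sqrt_div (by positivity), Real.sqrt_mul (by norm_num)]
          have h3 := (Real.sqrt_pos.2 hkR).ne'
          have h4 := (Real.sqrt_pos.2 hsR).ne'
          rw [h2, ha]; field_simp
    · have hIB : Disjoint (S ∪ J) B := hIu.mono_right hB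
      have hBham : hammingNorm (restrict B w) ≤ k :=
        (hammingNorm_le_card (A := B) fun i hi => by simp only [restrict, if_neg hi]).trans hBk
      refine two_mul_neg_dotProduct_mul_le (r := r) hη0 (restrict_dotProduct_restrict hIB w)
        (fun t => sparseEigMin_mul_sq_le X ?_) ?_
      · refine (hammingNorm_le_card (A := (S ∪ J) ∪ B) fun i hi => ?_).trans
          ((Finset.card_union_le _ _).trans (by omega))
        rw [Finset.mem_union, not_or] at hi
        simp only [hv, Pi.add_apply, Pi.smul_apply, restrict, if_neg hi.1, if_neg hi.2]
        simp
      · refine (sq_le_sparseEigMax_mul X hBham).trans ?_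
        rw [mul_comm r]
        exact mul_le_mul_of_nonneg_right hratio (sq_nonneg _)
  rcases (l2norm_nonneg v).eq_or_lt with hv0 | hv0
  · have hu0 : l2norm u = 0 := le_antisymm (by simpa [← hv0] using hub) (l2norm_nonneg _)
    rw [hwvu, l2norm_eq_zero.1 hu0, l2norm_eq_zero.1 hv0.symm, add_zero, l2norm_zero]
    have : 0 < 1 - a := by linarith
    positivity
  have hcross' : -((X *ᵥ v) ⬝ᵥ (X *ᵥ u)) ≤ l2norm (X *ᵥ v) ^ 2 * (a / 2) := by
    have h1 : -((X *ᵥ v) ⬝ᵥ (X *ᵥ u)) * l2norm v ≤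
        l2norm (X *ᵥ v) ^ 2 * (a / 2) * l2norm v := by linarith
    exact le_of_mul_le_mul_right h1 hv0
  -- testing the stationarity condition against `v`
  have htest : (X *ᵥ v) ⬝ᵥ (X *ᵥ w) ≤ lam * (1 + τ) * (√(s : ℝ) * l2norm v) := by
    rw [← dotProduct_gram, ← Matrix.mulVec_mulVec, hv, restrict_dotProduct,
      Finset.sum_union hSJ]
    have h1 := hsumS S subset_rfl
    have h2 := hsumT J hJ.subset
    have h3 : 0 ≤ lam * (1 - τ) * ∑ i ∈ J, |w i| :=
      mul_nonneg (by positivity) (Finset.sum_nonneg fun _ _ => abs_nonneg _)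
    have h4 : lam * (1 + τ) * ∑ i ∈ S, |w i| ≤ lam * (1 + τ) * (√(s : ℝ) * l2norm v) :=
      mul_le_mul_of_nonneg_left hSv (by positivity)
    linarith
  have hq : (X *ᵥ v) ⬝ᵥ (X *ᵥ w) = l2norm (X *ᵥ v) ^ 2 + (X *ᵥ v) ⬝ᵥ (X *ᵥ u) := by
    conv_lhs => rw [hwvu]
    rw [Matrix.mulVec_add, dotProduct_add, l2norm_sq]
  have hlow := sparseEigMin_mul_sq_le X hvham
  have hvb : ρ * (l2norm v * (1 - a / 2)) ≤ lam * (1 + τ) * √(s : ℝ) := by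
    have h1 : l2norm (X *ᵥ v) ^ 2 * (1 - a / 2) ≤ lam * (1 + τ) * (√(s : ℝ) * l2norm v) := by
      linarith
    have h2 : ρ * l2norm v ^ 2 * (1 - a / 2) ≤ l2norm (X *ᵥ v) ^ 2 * (1 - a / 2) :=
      mul_le_mul_of_nonneg_right hlow (by linarith)
    refine le_of_mul_le_mul_right ?_ hv0
    linarith
  -- `‖w‖² ≤ (1 + a²) ‖v‖²` by orthogonality, and `√(1 + a²) (1 - a) ≤ 1 - a / 2` on `[0, 1]`
  have hwb : l2norm w * (1 - a) ≤ l2norm v * (1 - a / 2) := by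
    refine le_of_sq_le_sq ?_ (mul_nonneg hv0.le (by linarith))
    have h1 : l2norm w ^ 2 = l2norm v ^ 2 + l2norm u ^ 2 := by
      have := l2norm_sq_add_smul v u 1
      rw [one_smul, restrict_dotProduct_restrict hIu, ← hwvu] at this
      linarith
    have h2 : l2norm u ^ 2 ≤ a ^ 2 * l2norm v ^ 2 := by
      rw [← mul_pow]; exact pow_le_pow_left₀ (l2norm_nonneg _) hub 2
    have h3 : (1 + a ^ 2) * (1 - a) ^ 2 ≤ (1 - a / 2) ^ 2 := by
      nlinarith [mul_nonneg ha0 (sub_nonneg.2 hγ.le), mul_nonneg ha0 ha0,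
        mul_nonneg (mul_nonneg ha0 ha0) (sub_nonneg.2 hγ.le),
        mul_nonneg (mul_nonneg ha0 (mul_nonneg ha0 ha0)) (sub_nonneg.2 hγ.le)]
    rw [mul_pow, mul_pow, h1]
    calc (l2norm v ^ 2 + l2norm u ^ 2) * (1 - a) ^ 2
        ≤ (l2norm v ^ 2 + a ^ 2 * l2norm v ^ 2) * (1 - a) ^ 2 := by gcongr
      _ = l2norm v ^ 2 * ((1 + a ^ 2) * (1 - a) ^ 2) := by ring
      _ ≤ _ := by gcongr
  have ha1 : 0 < 1 - a := by linarith
  rw [div_mul_eq_mul_div, le_div_iff₀ (mul_pos hρ0 ha1)]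
  calc l2norm w * (ρ * (1 - a)) = ρ * (l2norm w * (1 - a)) := by ring
    _ ≤ ρ * (l2norm v * (1 - a / 2)) := mul_le_mul_of_nonneg_left hwb hρ0.le
    _ ≤ _ := hvb

/-! ### Concentration of Gaussian sketches -/

/-- The moment generating function of a chi-squared variable with one degree of freedom. -/
theorem mgf_sq_gaussianReal {t : ℝ} (ht : t < 1 / 2) :
    mgf (fun x => x ^ 2) (gaussianReal 0 1) t = √((1 - 2 * t)⁻¹) := by
  have h : ∀ x : ℝ, gaussianPDFReal 0 1 x • Real.exp (t * x ^ 2) =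
      (√(2 * Real.pi))⁻¹ * Real.exp (-(1 / 2 - t) * x ^ 2) := by
    intro x
    simp only [gaussianPDFReal, NNReal.coe_one, mul_one, sub_zero, smul_eq_mul, mul_assoc,
      ← Real.exp_add]
    congr 2
    ring
  rw [mgf, integral_gaussianReal_eq_integral_smul one_ne_zero]
  simp_rw [h]
  rw [integral_const_mul, integral_gaussian, ← Real.sqrt_inv, ← Real.sqrt_mul (by positivity)]
  congr 1
  have : 1 - 2 * t ≠ 0 := by linarith
  have h2 : 1 / 2 - t ≠ 0 := by linarith
  field_simp

theorem mgf_sq_gaussianReal_le {t : ℝ} (ht : |t| ≤ 1 / 4) :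
    mgf (fun x => x ^ 2) (gaussianReal 0 1) t ≤ Real.exp (t + 4 * t ^ 2) := by
  have ht' := abs_le.1 ht
  rw [mgf_sq_gaussianReal (by linarith)]
  refine Real.sqrt_le_iff.2 ⟨(Real.exp_pos _).le, ?_⟩
  have h1 : |2 * t| ≤ 1 / 2 := by rw [abs_mul, abs_two]; linarith
  have h2 := Real.abs_log_sub_add_sum_range_le (h1.trans_lt (by norm_num)) 1
  have h3 : |2 * t| ^ (1 + 1) / (1 - |2 * t|) ≤ 8 * t ^ 2 := by
    rw [div_le_iff₀ (by linarith), sq_abs]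
    nlinarith [sq_nonneg t]
  have h4 := (abs_le.1 (h2.trans h3)).1
  simp at h4
  rw [← Real.exp_nat_mul, ← Real.exp_log (show 0 < (1 - 2 * t)⁻¹ by
    rw [inv_pos]; linarith), Real.log_inv]
  refine Real.exp_le_exp.2 ?_
  push_cast
  linarith

variable {Ω : Type*} [MeasurableSpace Ω] {Pr : Measure Ω}

/-- Concentration of the sum of squares of independent standard Gaussian variables, by Chernoff
bounds. -/
theorem measureReal_sum_sq_gaussian_le [IsProbabilityMeasure Pr] {m : ℕ} {Z : Fin m → Ω → ℝ}
    (hZ : ∀ i, HasLaw (Z i) (gaussianReal 0 1) Pr) (hind : iIndepFun Z Pr)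
    {η : ℝ} (hη0 : 0 ≤ η) (hη1 : η ≤ 1) :
    Pr.real {ω | m * η ≤ |∑ i, Z i ω ^ 2 - m|} ≤ 2 * Real.exp (-(m * η ^ 2 / 16)) := by
  set Q : Ω → ℝ := ∑ i, fun ω => Z i ω ^ 2 with hQ
  have hQω : ∀ ω, Q ω = ∑ i, Z i ω ^ 2 := fun ω => by simp [hQ]
  have hind2 : iIndepFun (fun i ω => Z i ω ^ 2) Pr :=
    hind.comp (fun _ x => x ^ 2) fun _ => by fun_prop
  have hmgf1 : ∀ i t, mgf (fun ω => Z i ω ^ 2) Pr t =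
      mgf (fun x => x ^ 2) (gaussianReal 0 1) t := by
    intro i t
    rw [← (hZ i).map_eq, mgf_map (hZ i).aemeasurable (by fun_prop)]
    rfl
  have hmgf : ∀ t, mgf Q Pr t = mgf (fun x => x ^ 2) (gaussianReal 0 1) t ^ m := by
    intro t
    rw [hQ, hind2.mgf_sum₀ (fun i => (hZ i).aemeasurable.pow_const 2)]
    simp [hmgf1]
  have hint : ∀ t, |t| ≤ 1 / 4 → Integrable (fun ω => Real.exp (t * Q ω)) Pr := by
    intro t ht
    have ht' := (abs_le.1 ht).2
    rw [← mgf_pos_iff, hmgf, mgf_sq_gaussianReal (by linarith)]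
    have : 0 < 1 - 2 * t := by linarith
    positivity
  have hle : ∀ t, |t| ≤ 1 / 4 → mgf Q Pr t ≤ Real.exp (m * (t + 4 * t ^ 2)) := by
    intro t ht
    rw [hmgf, Real.exp_nat_mul]
    exact pow_le_pow_left₀ mgf_nonneg (mgf_sq_gaussianReal_le ht) m
  -- the Chernoff bounds at `t = ± η / 8`
  have hup : Pr.real {ω | m * (1 + η) ≤ Q ω} ≤ Real.exp (-(m * η ^ 2 / 16)) := by
    have ht : |η / 8| ≤ 1 / 4 := by rw [abs_of_nonneg (by positivity)]; linarith
    refine (measure_ge_le_exp_mul_mgf _ (by positivity : 0 ≤ η / 8) (hint _ ht)).trans ?_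
    refine (mul_le_mul_of_nonneg_left (hle _ ht) (Real.exp_pos _).le).trans ?_
    rw [← Real.exp_add]
    exact Real.exp_le_exp.2 (le_of_eq (by ring))
  have hlow : Pr.real {ω | Q ω ≤ m * (1 - η)} ≤ Real.exp (-(m * η ^ 2 / 16)) := by
    have ht : |-(η / 8)| ≤ 1 / 4 := by rw [abs_neg, abs_of_nonneg (by positivity)]; linarith
    refine (measure_le_le_exp_mul_mgf _ (by linarith : -(η / 8) ≤ 0) (hint _ ht)).trans ?_
    refine (mul_le_mul_of_nonneg_left (hle _ ht) (Real.exp_pos _).le).trans ?_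
    rw [← Real.exp_add]
    exact Real.exp_le_exp.2 (le_of_eq (by ring))
  have hsub : {ω | m * η ≤ |∑ i, Z i ω ^ 2 - m|} ⊆
      {ω | m * (1 + η) ≤ Q ω} ∪ {ω | Q ω ≤ m * (1 - η)} := by
    intro ω hω
    rw [Set.mem_ofPred_eq, ← hQω, le_abs] at hω
    rcases hω with h | h
    · left; rw [Set.mem_ofPred_eq]; linarith
    · right; rw [Set.mem_ofPred_eq]; linarith
  calc _ ≤ _ := measureReal_mono hsub
    _ ≤ _ := measureReal_union_le _ _
    _ ≤ _ := by linarith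

/-- The product of a standard Gaussian matrix and a unit vector is a standard Gaussian vector. -/
theorem gaussian_mulVec_unit {m n : ℕ} {G : Ω → Matrix (Fin m) (Fin n) ℝ}
    (hG : ∀ i j, HasLaw (fun ω => G ω i j) (gaussianReal 0 1) Pr)
    (hind : iIndepFun (fun (p : Fin m × Fin n) ω => G ω p.1 p.2) Pr)
    {w : Fin n → ℝ} (hw : l2norm w = 1) :
    (∀ i, HasLaw (fun ω => (G ω *ᵥ w) i) (gaussianReal 0 1) Pr) ∧
      iIndepFun (fun (i : Fin m) ω => (G ω *ᵥ w) i) Pr := by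
  have := hind.isProbabilityMeasure
  have hGl : ∀ p : Fin m × Fin n, HasGaussianLaw (fun ω => G ω p.1 p.2) Pr := by
    intro p
    have h1 : IsGaussian (Pr.map fun ω => G ω p.1 p.2) := by
      rw [(hG p.1 p.2).map_eq]; infer_instance
    exact h1.hasGaussianLaw
  have hjoint := hind.hasGaussianLaw hGl
  have hL2 : ∀ i j, MemLp (fun ω => G ω i j) 2 Pr := fun i j => (hGl (i, j)).memLp_two
  have hcov : ∀ i j i' j', cov[fun ω => G ω i j, fun ω => G ω i' j'; Pr] =
      if i = i' ∧ j = j' then 1 else 0 := by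
    intro i j i' j'
    split_ifs with h
    · obtain ⟨rfl, rfl⟩ := h
      rw [covariance_self (hL2 i j).aemeasurable, (hG i j).variance_eq]
      simp [variance_id_gaussianReal]
    · have hne : (i, j) ≠ (i', j') := by simpa [Prod.ext_iff] using h
      exact (hind.indepFun hne).covariance_eq_zero (hL2 i j) (hL2 i' j')
  have hrow : ∀ i ω, (G ω *ᵥ w) i = ∑ j, w j * G ω i j := by
    intro i ω
    simp [Matrix.mulVec, dotProduct, mul_comm]
  have hL2' : ∀ i j, MemLp (fun ω => w j * G ω i j) 2 Pr := fun i j => (hL2 i j).const_mul _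
  have hcov2 : ∀ i i', cov[fun ω => (G ω *ᵥ w) i, fun ω => (G ω *ᵥ w) i'; Pr] =
      if i = i' then 1 else 0 := by
    intro i i'
    simp_rw [hrow]
    rw [covariance_fun_sum_fun_sum (hL2' i) (hL2' i')]
    simp_rw [covariance_const_mul_left, covariance_const_mul_right, hcov]
    split_ifs with h
    · have h2 := l2norm_sq_eq_sum w
      rw [hw, one_pow] at h2
      simpa [h, sq] using h2.symm
    · simp [h]
  -- the vector `G w` is a linear image of the Gaussian family of entries
  have hZ : HasGaussianLaw (fun ω i => (G ω *ᵥ w) i) Pr := by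
    let L : ((Fin m × Fin n) → ℝ) →L[ℝ] (Fin m → ℝ) :=
      ContinuousLinearMap.pi fun i => ∑ j, w j • ContinuousLinearMap.proj (i, j)
    have h := hjoint.map_fun L
    refine h.congr (ae_of_all _ fun ω => ?_)
    ext i
    change L (fun p => G ω p.1 p.2) i = (G ω *ᵥ w) i
    rw [hrow]
    simp [L]
  refine ⟨fun i => ⟨(hZ.eval i).aemeasurable, ?_⟩, hZ.iIndepFun_of_covariance_eq_zero
    fun i j hij => by rw [hcov2, if_neg hij]⟩
  rw [(hZ.eval i).map_eq_gaussianReal, ← covariance_self (hZ.eval i).aemeasurable, hcov2,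
    if_pos rfl]
  have hmean : ∫ ω, (G ω *ᵥ w) i ∂Pr = 0 := by
    simp_rw [hrow]
    rw [integral_finsetSum _ fun j _ => (hL2' i j).integrable one_le_two]
    refine Finset.sum_eq_zero fun j _ => ?_
    rw [integral_const_mul, (hG i j).integral_eq, integral_id_gaussianReal, mul_zero]
  rw [hmean]
  simp

/-- A Gaussian sketch distorts the norm of a fixed vector by more than a factor `1 ± η` only with
exponentially small probability. -/
theorem IsGaussianSketch.measureReal_distortion_le {m n : ℕ}
    [IsProbabilityMeasure Pr] {P : Ω → Matrix (Fin m) (Fin n) ℝ}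
    (hP : IsGaussianSketch Pr P) (hm : 0 < m) {η : ℝ} (hη0 : 0 ≤ η) (hη1 : η ≤ 1)
    (w : Fin n → ℝ) :
    Pr.real {ω | η * l2norm w ^ 2 < |l2norm (P ω *ᵥ w) ^ 2 - l2norm w ^ 2|} ≤
      2 * Real.exp (-(m * η ^ 2 / 16)) := by
  obtain ⟨G, hG, hind, hPG⟩ := hP
  rcases (l2norm_nonneg w).eq_or_lt with h0 | h0
  · have : w = 0 := l2norm_eq_zero.1 h0.symm
    subst this
    simp
    positivity
  set u := (l2norm w)⁻¹ • w with hu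
  have hu1 : l2norm u = 1 := by
    rw [hu, l2norm_smul, abs_of_pos (inv_pos.2 h0), inv_mul_cancel₀ h0.ne']
  have hwu : w = l2norm w • u := by rw [hu, smul_smul, mul_inv_cancel₀ h0.ne', one_smul]
  obtain ⟨hlaw, hi⟩ := gaussian_mulVec_unit hG hind hu1
  have hm' : (0 : ℝ) < m := by exact_mod_cast hm
  refine (measureReal_mono ?_).trans (measureReal_sum_sq_gaussian_le hlaw hi hη0 hη1)
  intro ω hω
  rw [Set.mem_ofPred_eq] at hω ⊢
  have e : l2norm (P ω *ᵥ w) ^ 2 - l2norm w ^ 2 =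
      l2norm w ^ 2 * ((∑ i, (G ω *ᵥ u) i ^ 2 - m) / m) := by
    rw [← l2norm_sq_eq_sum]
    conv_lhs => rw [hwu]
    rw [hPG, Matrix.mulVec_smul, Matrix.smul_mulVec, l2norm_smul, l2norm_smul, l2norm_smul, hu1]
    simp only [mul_pow, sq_abs, inv_pow, Real.sq_sqrt hm'.le]
    field_simp
  have h2 : 0 < l2norm w ^ 2 := by positivity
  rw [e, abs_mul, abs_of_pos h2, mul_comm, mul_lt_mul_iff_right₀ h2, abs_div,
    abs_of_pos hm', lt_div_iff₀ hm'] at hω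
  linarith

/-! ### Subspace embeddings and the column space -/

/-- The column space of `X`, as a subspace of Euclidean space. -/
def colSpace {n d : ℕ} (X : Matrix (Fin n) (Fin d) ℝ) : Submodule ℝ (EuclideanSpace ℝ (Fin n)) :=
  (LinearMap.range X.mulVecLin).map (WithLp.linearEquiv 2 ℝ (Fin n → ℝ)).symm.toLinearMap

theorem finrank_colSpace {n d : ℕ} (X : Matrix (Fin n) (Fin d) ℝ) :
    Module.finrank ℝ (colSpace X) = X.rank := by
  rw [colSpace, LinearEquiv.finrank_map_eq]
  rfl

/-- The action of a matrix on the column space of `X`, with values in Euclidean space. -/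
noncomputable def colSpaceMap {m n d : ℕ} (P : Matrix (Fin m) (Fin n) ℝ)
    (X : Matrix (Fin n) (Fin d) ℝ) :
    colSpace X →L[ℝ] EuclideanSpace ℝ (Fin m) :=
  (Matrix.toEuclideanLin P).toContinuousLinearMap ∘L (colSpace X).subtypeL

theorem norm_colSpaceMap {m n d : ℕ} (P : Matrix (Fin m) (Fin n) ℝ)
    (X : Matrix (Fin n) (Fin d) ℝ) (x : colSpace X) :
    ‖colSpaceMap P X x‖ = l2norm (P *ᵥ (x : EuclideanSpace ℝ (Fin n)).ofLp) := rfl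

theorem norm_colSpace {n d : ℕ} {X : Matrix (Fin n) (Fin d) ℝ} (x : colSpace X) :
    ‖x‖ = l2norm (x : EuclideanSpace ℝ (Fin n)).ofLp := rfl

theorem isSubspaceEmbedding_of_colSpaceMap {m n d : ℕ} {P : Matrix (Fin m) (Fin n) ℝ}
    {X : Matrix (Fin n) (Fin d) ℝ} {ε : ℝ}
    (h : ∀ x : colSpace X, |‖colSpaceMap P X x‖ ^ 2 - ‖x‖ ^ 2| ≤ ε * ‖x‖ ^ 2) :
    IsSubspaceEmbedding ε P X := by
  intro β
  have hx : WithLp.toLp 2 (X *ᵥ β) ∈ colSpace X :=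
    Submodule.mem_map.2 ⟨X *ᵥ β, ⟨β, rfl⟩, rfl⟩
  have h1 := abs_le.1 (h ⟨_, hx⟩)
  rw [norm_colSpaceMap, norm_colSpace] at h1
  constructor <;> linarith [h1.1, h1.2]

theorem isSubspaceEmbedding_of_rank_eq_zero {m n d : ℕ} {P : Matrix (Fin m) (Fin n) ℝ}
    {X : Matrix (Fin n) (Fin d) ℝ} {ε : ℝ} (h : X.rank = 0) : IsSubspaceEmbedding ε P X := by
  refine isSubspaceEmbedding_of_colSpaceMap fun x => ?_
  rw [← finrank_colSpace, Module.finrank_zero_iff] at h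
  rw [Subsingleton.elim x 0]
  simp

theorem nullMeasurableSet_isSubspaceEmbedding {m n d : ℕ} {P : Ω → Matrix (Fin m) (Fin n) ℝ}
    (hP : ∀ i j, AEMeasurable (fun ω => P ω i j) Pr) (ε : ℝ) (X : Matrix (Fin n) (Fin d) ℝ) :
    NullMeasurableSet {ω | IsSubspaceEmbedding ε (P ω) X} Pr := by
  have h1 : AEMeasurable (fun ω i j => P ω i j) Pr :=
    aemeasurable_pi_iff.2 fun i => aemeasurable_pi_iff.2 fun j => hP i j
  have h2 : IsClosed {A : Fin m → Fin n → ℝ | IsSubspaceEmbedding ε (Matrix.of A) X} := by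
    have h3 : ∀ β : Fin d → ℝ, Continuous fun A : Fin m → Fin n → ℝ =>
        l2norm (Matrix.of A *ᵥ (X *ᵥ β)) ^ 2 := by
      intro β
      simp only [l2norm_sq_eq_sum, Matrix.mulVec, dotProduct, Matrix.of_apply]
      fun_prop
    simp only [IsSubspaceEmbedding, Set.ofPred_forall]
    exact isClosed_iInter fun β =>
      (isClosed_le continuous_const (h3 β)).inter (isClosed_le (h3 β) continuous_const)
  exact h1.nullMeasurableSet_preimage h2.measurableSet

theorem one_sub_le_measureReal_of_compl [IsProbabilityMeasure Pr] {A : Set Ω} {δ : ℝ}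
    (h : Pr.real Aᶜ ≤ δ) : 1 - δ ≤ Pr.real A := by
  have h1 := measureReal_union_le (μ := Pr) A Aᶜ
  rw [Set.union_compl_self, probReal_univ] at h1
  linarith

/-! ### Nets on the unit sphere -/

section Nets

variable {E F : Type*} [NormedAddCommGroup E] [NormedSpace ℝ E]

/-- The unit sphere of a space of dimension `r` has a `1/2`-net with at most `5 ^ r` elements,
namely a maximal `1/2`-separated set. -/
theorem exists_half_net [FiniteDimensional ℝ E] :
    ∃ N : Finset E, N.card ≤ 5 ^ Module.finrank ℝ E ∧ (∀ z ∈ N, ‖z‖ = 1) ∧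
      ∀ x : E, ‖x‖ = 1 → ∃ z ∈ N, ‖x - z‖ ≤ 1 / 2 := by
  classical
  set Sep : Finset E → Prop := fun s =>
    (∀ z ∈ s, ‖z‖ = 1) ∧ ∀ z ∈ s, ∀ z' ∈ s, z ≠ z' → 1 / 2 ≤ ‖z - z'‖ with hSep
  have hcard : ∀ s, Sep s → s.card ≤ 5 ^ Module.finrank ℝ E := by
    intro s hs
    have hinj : Function.Injective fun z : E => (2 : ℝ) • z := smul_right_injective E two_ne_zero
    rw [← Finset.card_image_of_injective s hinj]
    refine Besicovitch.card_le_of_separated _ ?_ ?_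
    · intro c hc
      obtain ⟨z, hz, rfl⟩ := Finset.mem_image.1 hc
      simp [norm_smul, hs.1 z hz]
    · intro c hc c' hc' hne
      obtain ⟨z, hz, rfl⟩ := Finset.mem_image.1 hc
      obtain ⟨z', hz', rfl⟩ := Finset.mem_image.1 hc'
      have hzz : z ≠ z' := fun h => hne (by rw [h])
      have := hs.2 z hz z' hz' hzz
      rw [← smul_sub, norm_smul, Real.norm_two]
      linarith
  set Q : ℕ → Prop := fun c => ∃ s, Sep s ∧ s.card = c with hQ
  have hQ0 : Q 0 := ⟨∅, by simp [hSep], rfl⟩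
  obtain ⟨N, hN, hNc⟩ := Nat.findGreatest_spec (P := Q) (Nat.zero_le (5 ^ Module.finrank ℝ E)) hQ0
  refine ⟨N, hcard N hN, hN.1, fun x hx => ?_⟩
  by_contra! hfar
  have hxN : x ∉ N := fun h => by have := hfar x h; simp at this; linarith
  have hins : Sep (insert x N) := by
    refine ⟨fun z hz => ?_, fun z hz z' hz' hne => ?_⟩
    · rcases Finset.mem_insert.1 hz with rfl | hz
      · exact hx
      · exact hN.1 z hz
    · rcases Finset.mem_insert.1 hz with h1 | h1 <;> rcases Finset.mem_insert.1 hz' with h2 | h2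
      · exact absurd (h1.trans h2.symm) hne
      · rw [h1]; exact (hfar z' h2).le
      · rw [h2, norm_sub_rev]; exact (hfar z h1).le
      · exact hN.2 z h1 z' h2 hne
  have h1 := Nat.le_findGreatest (P := Q) (hcard _ hins) ⟨_, hins, rfl⟩
  rw [← hNc, Finset.card_insert_of_notMem hxN] at h1
  omega

/-- A `1/2`-net of the unit sphere determines the operator norm up to a factor `2`. -/
theorem opNorm_le_two_mul_of_half_net [NormedAddCommGroup F] [NormedSpace ℝ F] {N : Finset E}
    (hN : ∀ x : E, ‖x‖ = 1 → ∃ z ∈ N, ‖x - z‖ ≤ 1 / 2) (T : E →L[ℝ] F) {K : ℝ} (hK : 0 ≤ K)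
    (h : ∀ z ∈ N, ‖T z‖ ≤ K) : ‖T‖ ≤ 2 * K := by
  have h1 : ‖T‖ ≤ K + ‖T‖ * (1 / 2) := by
    refine ContinuousLinearMap.opNorm_le_of_unit_norm (by positivity) fun x hx => ?_
    obtain ⟨z, hz, hxz⟩ := hN x hx
    calc ‖T x‖ = ‖T z + T (x - z)‖ := by rw [← map_add]; congr 2; abel
      _ ≤ ‖T z‖ + ‖T (x - z)‖ := norm_add_le _ _
      _ ≤ K + ‖T‖ * (1 / 2) :=
        add_le_add (h z hz) ((T.le_opNorm _).trans (mul_le_mul_of_nonneg_left hxz (norm_nonneg _)))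
  linarith

/-- In dimension `r`, it suffices to control the distortion of `2 * 25 ^ r` fixed vectors, the sums
and differences of elements of a `1/2`-net, to control the distortion of all vectors. By
polarization they control `⟨A z, z'⟩` for `z`, `z'` in the net, where `A = T† T - 1`; applying the net bound to
the functionals `⟨A z, ·⟩` and then to `A` controls `‖A‖`. -/
theorem exists_distortion_test_set {E : Type*} [NormedAddCommGroup E] [InnerProductSpace ℝ E]
    [FiniteDimensional ℝ E] (F : Type*) [NormedAddCommGroup F] [InnerProductSpace ℝ F]
    [CompleteSpace F] :
    ∃ W : Finset E, W.card ≤ 2 * 25 ^ Module.finrank ℝ E ∧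
      ∀ (T : E →L[ℝ] F) (η : ℝ), 0 ≤ η → (∀ w ∈ W, |‖T w‖ ^ 2 - ‖w‖ ^ 2| ≤ η * ‖w‖ ^ 2) →
        ∀ x, |‖T x‖ ^ 2 - ‖x‖ ^ 2| ≤ 4 * η * ‖x‖ ^ 2 := by
  classical
  have : CompleteSpace E := FiniteDimensional.complete ℝ E
  obtain ⟨N, hcard, hN1, hN⟩ := exists_half_net (E := E)
  refine ⟨(N ×ˢ N).image (fun p => p.1 + p.2) ∪ (N ×ˢ N).image (fun p => p.1 - p.2), ?_, ?_⟩
  · have h1 : (N ×ˢ N).card ≤ 25 ^ Module.finrank ℝ E := by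
      rw [Finset.card_product]
      refine (Nat.mul_le_mul hcard hcard).trans (le_of_eq ?_)
      rw [← mul_pow]; norm_num
    refine (Finset.card_union_le _ _).trans ?_
    have h2 := (Finset.card_image_le (s := N ×ˢ N) (f := fun p : E × E => p.1 + p.2)).trans h1
    have h3 := (Finset.card_image_le (s := N ×ˢ N) (f := fun p : E × E => p.1 - p.2)).trans h1
    omega
  intro T η hη hW
  -- the symmetric operator whose quadratic form is the distortion
  set A : E →L[ℝ] E := (ContinuousLinearMap.adjoint T) ∘L T - ContinuousLinearMap.id ℝ E with hA
  have hAi : ∀ x y, inner ℝ (A x) y = inner ℝ (T x) (T y) - inner ℝ x y := by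
    intro x y
    simp [hA, inner_sub_left, ContinuousLinearMap.adjoint_inner_left]
  have hpair : ∀ z ∈ N, ∀ z' ∈ N, ‖innerSL ℝ (A z) z'‖ ≤ η := by
    intro z hz z' hz'
    have hm : (z, z') ∈ N ×ˢ N := Finset.mk_mem_product hz hz'
    have hp := abs_le.1 (hW (z + z') (Finset.mem_union_left _ (Finset.mem_image_of_mem _ hm)))
    have hs := abs_le.1 (hW (z - z') (Finset.mem_union_right _ (Finset.mem_image_of_mem _ hm)))
    rw [map_add, norm_add_sq_real, norm_add_sq_real, hN1 z hz, hN1 z' hz'] at hp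
    rw [map_sub, norm_sub_sq_real, norm_sub_sq_real, hN1 z hz, hN1 z' hz'] at hs
    rw [innerSL_apply_apply, hAi, Real.norm_eq_abs, abs_le]
    constructor <;> nlinarith [hp.1, hp.2, hs.1, hs.2]
  have hAz : ∀ z ∈ N, ‖A z‖ ≤ 2 * η := by
    intro z hz
    rw [← innerSL_apply_norm ℝ (A z)]
    exact opNorm_le_two_mul_of_half_net hN _ hη (hpair z hz)
  have hAn : ‖A‖ ≤ 2 * (2 * η) := opNorm_le_two_mul_of_half_net hN A (by positivity) hAz
  intro x
  have h1 : ‖T x‖ ^ 2 - ‖x‖ ^ 2 = inner ℝ (A x) x := by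
    rw [hAi, real_inner_self_eq_norm_sq, real_inner_self_eq_norm_sq]
  rw [h1]
  calc |inner ℝ (A x) x| ≤ ‖A x‖ * ‖x‖ := abs_real_inner_le_norm _ _
    _ ≤ (‖A‖ * ‖x‖) * ‖x‖ := by gcongr; exact A.le_opNorm x
    _ ≤ ((2 * (2 * η)) * ‖x‖) * ‖x‖ := by gcongr
    _ = _ := by ring

end Nets

/-! ### Gaussian sketches are subspace embeddings -/

/-- Union bound over the test set: with `r = X.rank`, the failure probability is at most
`4 * 25 ^ r * exp (-m ε² / 256)`, and `4 * 25 ^ r ≤ exp (5 r)`, whence the constant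
`1280 = 5 * 256`. In rank `0` the embedding property is void. -/
theorem IsGaussianSketch.isRandomSubspaceEmbedding [IsProbabilityMeasure Pr] {m n d : ℕ}
    {P : Ω → Matrix (Fin m) (Fin n) ℝ} (hP : IsGaussianSketch Pr P) (X : Matrix (Fin n) (Fin d) ℝ)
    {ε δ : ℝ} (hε0 : 0 < ε) (hε1 : ε ≤ 1) (hδ0 : 0 < δ) (hδ1 : δ < 1)
    (hm : 1280 * (((X.rank : ℝ) + Real.log (1 / δ)) * (1 / ε ^ 2)) ≤ m) :
    IsRandomSubspaceEmbedding Pr ε δ P X := by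
  refine ⟨?_, one_sub_le_measureReal_of_compl ?_⟩
  · obtain ⟨G, hG, -, hPG⟩ := hP
    intro i j
    simp only [hPG, Matrix.smul_apply, smul_eq_mul]
    exact (hG i j).aemeasurable.const_mul _
  rcases Nat.eq_zero_or_pos X.rank with hr | hr
  · have : {ω | IsSubspaceEmbedding ε (P ω) X}ᶜ = ∅ := by
      simp [isSubspaceEmbedding_of_rank_eq_zero hr]
    rw [this]
    simpa using hδ0.le
  have hlog : 0 < Real.log (1 / δ) := Real.log_pos (by rw [lt_div_iff₀ hδ0]; linarith)
  have hrR : (1 : ℝ) ≤ X.rank := by exact_mod_cast hr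
  have hm' : 1280 * ((X.rank : ℝ) + Real.log (1 / δ)) ≤ m * ε ^ 2 := by
    have := mul_le_mul_of_nonneg_right hm (sq_nonneg ε)
    refine le_trans (le_of_eq ?_) this
    field_simp
  have hm0 : 0 < m := by
    rw [Nat.pos_iff_ne_zero]
    rintro rfl
    rw [Nat.cast_zero, zero_mul] at hm'
    linarith
  obtain ⟨W, hWc, hW⟩ :=
    exists_distortion_test_set (E := colSpace X) (EuclideanSpace ℝ (Fin m))
  set bad : colSpace X → Set Ω := fun w => {ω | ε / 4 *
    l2norm (w : EuclideanSpace ℝ (Fin n)).ofLp ^ 2 <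
      |l2norm (P ω *ᵥ (w : EuclideanSpace ℝ (Fin n)).ofLp) ^ 2 -
        l2norm (w : EuclideanSpace ℝ (Fin n)).ofLp ^ 2|} with hbad
  have hsub : {ω | IsSubspaceEmbedding ε (P ω) X}ᶜ ⊆ ⋃ w ∈ W, bad w := by
    intro ω hω
    by_contra hnot
    refine hω (isSubspaceEmbedding_of_colSpaceMap fun x => ?_)
    have h1 := hW (colSpaceMap (P ω) X) (ε / 4) (by positivity) (fun w hw => ?_) x
    · refine h1.trans (le_of_eq ?_)
      ring
    · by_contra! hlt
      exact hnot (Set.mem_biUnion hw hlt)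
  have hprob : ∀ w ∈ W, Pr.real (bad w) ≤ 2 * Real.exp (-(m * (ε / 4) ^ 2 / 16)) :=
    fun w _ => hP.measureReal_distortion_le hm0 (by positivity) (by linarith) _
  have hWc' : (W.card : ℝ) ≤ 2 * 25 ^ X.rank := by
    rw [finrank_colSpace] at hWc
    exact_mod_cast hWc
  have hexp : (4 : ℝ) * 25 ^ X.rank ≤ Real.exp (X.rank * 5) := by
    rw [Real.exp_nat_mul]
    have h1 : (100 : ℝ) ≤ Real.exp 5 := by
      have h2 : Real.exp 5 = Real.exp 1 ^ 5 := by rw [← Real.exp_nat_mul]; norm_num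
      have h3 : (2.7 : ℝ) ≤ Real.exp 1 := by linarith [Real.exp_one_gt_d9]
      rw [h2]
      exact le_trans (by norm_num) (pow_le_pow_left₀ (by norm_num) h3 5)
    calc (4 : ℝ) * 25 ^ X.rank ≤ 4 ^ X.rank * 25 ^ X.rank := by
          gcongr
          exact le_self_pow₀ (by norm_num) hr.ne'
      _ = 100 ^ X.rank := by rw [← mul_pow]; norm_num
      _ ≤ _ := pow_le_pow_left₀ (by norm_num) h1 _
  calc Pr.real {ω | IsSubspaceEmbedding ε (P ω) X}ᶜ
      ≤ Pr.real (⋃ w ∈ W, bad w) := measureReal_mono hsub (measure_ne_top _ _)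
    _ ≤ ∑ w ∈ W, Pr.real (bad w) := measureReal_biUnion_finset_le _ _
    _ ≤ W.card * (2 * Real.exp (-(m * (ε / 4) ^ 2 / 16))) := by
        rw [← nsmul_eq_mul]; exact Finset.sum_le_card_nsmul _ _ _ hprob
    _ ≤ (2 * 25 ^ X.rank) * (2 * Real.exp (-(m * (ε / 4) ^ 2 / 16))) := by gcongr
    _ = (4 * 25 ^ X.rank) * Real.exp (-(m * (ε / 4) ^ 2 / 16)) := by ring
    _ ≤ Real.exp (X.rank * 5) * Real.exp (-(m * (ε / 4) ^ 2 / 16)) := by gcongr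
    _ ≤ Real.exp (Real.log δ) := by
        rw [← Real.exp_add]
        refine Real.exp_le_exp.2 ?_
        rw [one_div, Real.log_inv] at hm' hlog
        nlinarith
    _ = δ := Real.exp_log hδ0

/-! ### Sparse sketches are subspace embeddings -/

/-- The sign encoded by a Boolean. -/
def boolSign (b : Bool) : ℝ := if b then 1 else -1

theorem boolSign_not (b : Bool) : boolSign (!b) = -boolSign b := by cases b <;> simp [boolSign]

theorem boolSign_mul_self (b : Bool) : boolSign b * boolSign b = 1 := by
  cases b <;> simp [boolSign]

/-- The inner product of the columns `p.1` and `p.2` of the sparse sketch with rows and signs `f`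
if these columns are different, and `0` otherwise. -/
def collision {m n : ℕ} (p : Fin n × Fin n) (f : Fin n → Fin m × Bool) : ℝ :=
  if p.1 ≠ p.2 ∧ (f p.1).1 = (f p.2).1 then boolSign (f p.1).2 * boolSign (f p.2).2 else 0

theorem collision_swap {m n : ℕ} (p : Fin n × Fin n) (f : Fin n → Fin m × Bool) :
    collision p.swap f = collision p f := by
  simp only [collision, Prod.fst_swap, Prod.snd_swap, ne_comm (a := p.2), eq_comm (a := (f p.2).1),
    mul_comm (boolSign (f p.2).2)]

/-- Two collisions are orthogonal if some column occurs in one pair only, since its sign is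
symmetric. -/
theorem sum_collision_mul_eq_zero_of_notMem {m n : ℕ} {p q : Fin n × Fin n} {i : Fin n}
    (hp : p.1 ≠ p.2) (hi : i = p.1 ∨ i = p.2) (h1 : q.1 ≠ i) (h2 : q.2 ≠ i) :
    ∑ f : Fin n → Fin m × Bool, collision p f * collision q f = 0 := by
  classical
  -- flipping the sign of column `i` flips the sign of the summand
  let e : (Fin n → Fin m × Bool) ≃ (Fin n → Fin m × Bool) :=
    Equiv.piCongrRight fun t =>
      if t = i then Equiv.prodCongr (Equiv.refl _) Equiv.boolNot else Equiv.refl _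
  have he : ∀ f t, e f t = if t = i then ((f t).1, !(f t).2) else f t := by
    intro f t
    by_cases h : t = i
    · simp [e, h]
      rfl
    · simp [e, h]
  have hneg : ∀ f, collision p (e f) * collision q (e f) = -(collision p f * collision q f) := by
    intro f
    have hq : collision q (e f) = collision q f := by
      simp only [collision, he, if_neg h1, if_neg h2]
    have hpe : collision p (e f) = -collision p f := by
      rcases hi with rfl | rfl
      · simp only [collision, he, if_pos, if_neg hp.symm, boolSign_not, neg_mul]
        split_ifs <;> simp
      · simp only [collision, he, if_pos, if_neg hp, boolSign_not, mul_neg]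
        split_ifs <;> simp
    rw [hq, hpe, neg_mul]
  have h := Equiv.sum_comp e fun f => collision p f * collision q f
  simp_rw [hneg] at h
  rw [Finset.sum_neg_distrib] at h
  linarith

/-- Two different columns have the same row with probability `1 / m`. -/
theorem mul_sum_collision_mul_self {m n : ℕ} [NeZero m] {p : Fin n × Fin n} (hp : p.1 ≠ p.2) :
    (m : ℝ) * ∑ f : Fin n → Fin m × Bool, collision p f * collision p f =
      Fintype.card (Fin n → Fin m × Bool) := by
  classical
  have hsq : ∀ f : Fin n → Fin m × Bool, collision p f * collision p f =
      if (f p.1).1 = (f p.2).1 then 1 else 0 := by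
    intro f
    simp only [collision, ne_eq, hp, not_false_eq_true, true_and]
    split_ifs
    · rw [mul_mul_mul_comm, boolSign_mul_self, boolSign_mul_self, one_mul]
    · rw [zero_mul]
  -- shifting the row of column `p.1` cyclically does not change the sum
  have hshift : ∀ a : Fin m, ∑ f : Fin n → Fin m × Bool, collision p f * collision p f =
      ∑ f : Fin n → Fin m × Bool, if (f p.1).1 + a = (f p.2).1 then (1 : ℝ) else 0 := by
    intro a
    let e : (Fin n → Fin m × Bool) ≃ (Fin n → Fin m × Bool) :=
      Equiv.piCongrRight fun t =>
        if t = p.1 then Equiv.prodCongr (Equiv.addRight a) (Equiv.refl _) else Equiv.refl _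
    have h := Equiv.sum_comp e fun f => collision p f * collision p f
    rw [← h]
    refine Finset.sum_congr rfl fun f _ => ?_
    rw [hsq]
    simp [e, hp.symm]
  calc (m : ℝ) * ∑ f : Fin n → Fin m × Bool, collision p f * collision p f
      = ∑ a : Fin m, ∑ f : Fin n → Fin m × Bool, collision p f * collision p f := by simp
    _ = ∑ a : Fin m, ∑ f : Fin n → Fin m × Bool,
        if (f p.1).1 + a = (f p.2).1 then (1 : ℝ) else 0 :=
        Finset.sum_congr rfl fun a _ => hshift a
    _ = ∑ f : Fin n → Fin m × Bool, ∑ a : Fin m,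
        if (f p.1).1 + a = (f p.2).1 then (1 : ℝ) else 0 := Finset.sum_comm
    _ = ∑ f : Fin n → Fin m × Bool, 1 := by
        refine Finset.sum_congr rfl fun f _ => ?_
        have : ∀ a : Fin m, ((f p.1).1 + a = (f p.2).1) ↔ a = (f p.2).1 - (f p.1).1 := by
          intro a
          rw [eq_sub_iff_add_eq, add_comm]
        simp [this]
    _ = _ := by simp

/-- Collisions of different unordered pairs of columns are uncorrelated. -/
theorem mul_sum_collision_mul {m n : ℕ} [NeZero m] {p : Fin n × Fin n} (hp : p.1 ≠ p.2)
    (q : Fin n × Fin n) :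
    (m : ℝ) * ∑ f : Fin n → Fin m × Bool, collision p f * collision q f =
      Fintype.card (Fin n → Fin m × Bool) *
        ((if q = p then 1 else 0) + (if q = p.swap then 1 else 0)) := by
  have hps : p ≠ p.swap := fun h => hp (congrArg Prod.fst h)
  by_cases h1 : q = p
  · subst h1
    rw [mul_sum_collision_mul_self hp, if_pos rfl, if_neg hps]; ring
  by_cases h2 : q = p.swap
  · subst h2
    simp_rw [collision_swap]
    rw [mul_sum_collision_mul_self hp, if_neg hps.symm, if_pos trivial]; ring
  rw [if_neg h1, if_neg h2]
  by_cases hq : q.1 = q.2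
  · simp [collision, hq]
  have hex : ∃ i, (i = p.1 ∨ i = p.2) ∧ q.1 ≠ i ∧ q.2 ≠ i := by
    by_contra! hno
    have ha := hno p.1 (Or.inl rfl)
    have hb := hno p.2 (Or.inr rfl)
    by_cases hc : q.1 = p.1
    · exact h1 (Prod.ext hc (hb (by rw [hc]; exact hp)))
    · have hd := ha hc
      refine h2 (Prod.ext ?_ hd)
      by_contra he
      exact hp (hd.symm.trans (hb he))
  obtain ⟨i, hi, hi1, hi2⟩ := hex
  rw [sum_collision_mul_eq_zero_of_notMem hp hi hi1 hi2]
  ring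

/-- Second moment of a linear combination of collisions. Only `q = p` and `q = p.swap` contribute
to the expanded square, and `c p * c p.swap` is bounded by the mean of the squares. -/
theorem mul_sum_sq_sum_collision_le {m n : ℕ} [NeZero m] (c : Fin n × Fin n → ℝ) :
    (m : ℝ) * ∑ f : Fin n → Fin m × Bool, (∑ p, c p * collision p f) ^ 2 ≤
      Fintype.card (Fin n → Fin m × Bool) * (2 * ∑ p, c p ^ 2) := by
  set N : ℝ := ((Fintype.card (Fin n → Fin m × Bool) : ℕ) : ℝ) with hN
  have hN0 : 0 ≤ N := by positivity
  have h1 : (m : ℝ) * ∑ f : Fin n → Fin m × Bool, (∑ p, c p * collision p f) ^ 2 =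
      ∑ p, ∑ q, c p * c q * ((m : ℝ) * ∑ f : Fin n → Fin m × Bool,
        collision p f * collision q f) := by
    simp_rw [sq, Finset.sum_mul_sum, Finset.mul_sum]
    rw [Finset.sum_comm]
    refine Finset.sum_congr rfl fun p _ => ?_
    rw [Finset.sum_comm]
    refine Finset.sum_congr rfl fun q _ => Finset.sum_congr rfl fun f _ => ?_
    ring
  have h2 : ∀ p, ∑ q, c p * c q * ((m : ℝ) * ∑ f : Fin n → Fin m × Bool,
      collision p f * collision q f) ≤ N * (3 / 2 * c p ^ 2 + 1 / 2 * c p.swap ^ 2) := by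
    intro p
    by_cases hp : p.1 = p.2
    · have : ∀ f : Fin n → Fin m × Bool, collision p f = 0 := fun f => by simp [collision, hp]
      simp [this]
      positivity
    · have : ∑ q, c p * c q * ((m : ℝ) * ∑ f : Fin n → Fin m × Bool,
          collision p f * collision q f) = N * (c p ^ 2 + c p * c p.swap) := by
        simp_rw [mul_sum_collision_mul hp, ← hN, mul_add, Finset.sum_add_distrib]
        simp
        ring
      rw [this]
      exact mul_le_mul_of_nonneg_left (by nlinarith [sq_nonneg (c p - c p.swap)]) hN0
  rw [h1]
  refine (Finset.sum_le_sum fun p _ => h2 p).trans (le_of_eq ?_)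
  have h3 : ∑ p : Fin n × Fin n, c p.swap ^ 2 = ∑ p, c p ^ 2 :=
    Equiv.sum_comp (Equiv.prodComm _ _) fun p => c p ^ 2
  rw [← Finset.mul_sum, Finset.sum_add_distrib, ← Finset.mul_sum, ← Finset.mul_sum, h3]
  ring

/-- The sparse sketch with rows and signs `f`. -/
def sparseMatrix {m n : ℕ} (f : Fin n → Fin m × Bool) : Matrix (Fin m) (Fin n) ℝ :=
  Matrix.of fun j i => if j = (f i).1 then boolSign (f i).2 else 0

/-- The diagonal terms of the sketched inner product sum to `x ⬝ᵥ y`, as the columns of the sketch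
are unit vectors; the collisions are the remaining terms. -/
theorem sparseMatrix_mulVec_dotProduct {m n : ℕ} (f : Fin n → Fin m × Bool) (x y : Fin n → ℝ) :
    (sparseMatrix f *ᵥ x) ⬝ᵥ (sparseMatrix f *ᵥ y) - x ⬝ᵥ y =
      ∑ p : Fin n × Fin n, x p.1 * y p.2 * collision p f := by
  have h1 : (sparseMatrix f *ᵥ x) ⬝ᵥ (sparseMatrix f *ᵥ y) =
      ∑ i, ∑ j, x i * y j *
        (if (f i).1 = (f j).1 then boolSign (f i).2 * boolSign (f j).2 else 0) := by
    simp only [Matrix.mulVec, dotProduct, sparseMatrix, Matrix.of_apply, Finset.sum_mul_sum]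
    rw [Finset.sum_comm]
    refine Finset.sum_congr rfl fun i _ => ?_
    rw [Finset.sum_comm]
    refine Finset.sum_congr rfl fun j _ => ?_
    simp only [ite_mul, zero_mul]
    rw [Finset.sum_ite_eq' Finset.univ (f i).1, if_pos (Finset.mem_univ _)]
    split_ifs
    · ring
    · ring
  have h2 : x ⬝ᵥ y = ∑ i, ∑ j, if i = j then x i * y j else 0 := by
    simp [dotProduct]
  rw [h1, h2, Fintype.sum_prod_type, ← Finset.sum_sub_distrib]
  refine Finset.sum_congr rfl fun i _ => ?_
  rw [← Finset.sum_sub_distrib]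
  refine Finset.sum_congr rfl fun j _ => ?_
  by_cases h : i = j
  · subst h
    simp [collision, boolSign_mul_self]
  · simp [collision, h]

/-- The distortion of an operator on a subspace is bounded by the Frobenius norm of the deviation
of its Gram matrix, in an orthonormal basis, from the identity. -/
theorem abs_norm_sq_sub_le_of_gram {E F : Type*} [NormedAddCommGroup E] [InnerProductSpace ℝ E]
    [NormedAddCommGroup F] [InnerProductSpace ℝ F] {ι : Type*} [Fintype ι]
    (u : OrthonormalBasis ι ℝ E) (T : E →L[ℝ] F) {ε : ℝ} (hε : 0 ≤ ε)
    (h : ∑ p : ι × ι, (inner ℝ (T (u p.1)) (T (u p.2)) - inner ℝ (u p.1) (u p.2)) ^ 2 ≤ ε ^ 2)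
    (x : E) : |‖T x‖ ^ 2 - ‖x‖ ^ 2| ≤ ε * ‖x‖ ^ 2 := by
  set a : ι → ℝ := fun i => inner ℝ (u i) x with ha
  have hx : x = ∑ i, a i • u i := (u.sum_repr' x).symm
  have hnorm : ‖x‖ ^ 2 = ∑ i, a i ^ 2 := by
    rw [← u.sum_sq_norm_inner_right x]; simp [ha]
  have hexp : ‖T x‖ ^ 2 - ‖x‖ ^ 2 = ∑ p : ι × ι, (a p.1 * a p.2) *
      (inner ℝ (T (u p.1)) (T (u p.2)) - inner ℝ (u p.1) (u p.2)) := by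
    have e1 : ‖T x‖ ^ 2 = ∑ i, ∑ j, a i * a j * inner ℝ (T (u i)) (T (u j)) := by
      rw [← real_inner_self_eq_norm_sq]
      conv_lhs => rw [hx]
      simp_rw [map_sum, map_smul, sum_inner, inner_sum, real_inner_smul_left,
        real_inner_smul_right, mul_assoc]
    have e2 : ‖x‖ ^ 2 = ∑ i, ∑ j, a i * a j * inner ℝ (u i) (u j) := by
      rw [← real_inner_self_eq_norm_sq]
      conv_lhs => rw [hx]
      simp_rw [sum_inner, inner_sum, real_inner_smul_left, real_inner_smul_right, mul_assoc]
    rw [e1, e2, Fintype.sum_prod_type, ← Finset.sum_sub_distrib]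
    refine Finset.sum_congr rfl fun i _ => ?_
    rw [← Finset.sum_sub_distrib]
    refine Finset.sum_congr rfl fun j _ => ?_
    ring
  have hprod : ∑ p : ι × ι, (a p.1 * a p.2) ^ 2 = (‖x‖ ^ 2) ^ 2 := by
    rw [hnorm, sq (∑ i, a i ^ 2), Finset.sum_mul_sum, Fintype.sum_prod_type]
    simp_rw [mul_pow]
  rw [hexp]
  refine abs_le_of_sq_le_sq ?_ (by positivity)
  refine (Finset.sum_mul_sq_le_sq_mul_sq _ _ _).trans ?_
  rw [hprod, mul_pow, mul_comm]
  gcongr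

/-- Independent uniform variables are jointly uniform. -/
theorem measureReal_preimage_of_uniform {α : Type*} [Fintype α] [Nonempty α] [MeasurableSpace α]
    [MeasurableSingletonClass α] {n : ℕ} {F : Fin n → Ω → α}
    (hF : ∀ i, HasLaw (F i) (uniformOn (Set.univ : Set α)) Pr) (hind : iIndepFun F Pr)
    (A : Finset (Fin n → α)) :
    Pr.real {ω | (fun i => F i ω) ∈ A} = A.card / Fintype.card (Fin n → α) := by
  have hlaw := hind.hasLaw_pi hF
  have hA : {ω | (fun i => F i ω) ∈ A} = (fun ω i => F i ω) ⁻¹' (A : Set (Fin n → α)) := rfl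
  rw [hA, ← map_measureReal_apply_of_aemeasurable hlaw.aemeasurable A.measurableSet, hlaw.map_eq,
    ← sum_measureReal_singleton]
  have h1 : ∀ f : Fin n → α, (Measure.pi fun _ => uniformOn (Set.univ : Set α)).real {f} =
      1 / Fintype.card (Fin n → α) := by
    intro f
    rw [Measure.real, Measure.pi_singleton]
    simp [uniformOn_univ, Finset.prod_const]
  simp_rw [h1]
  rw [Finset.sum_const, nsmul_eq_mul]
  ring

/-- Markov's inequality for the squared Frobenius norm of the deviation of the sketched Gram matrix,
in an orthonormal basis of the column space, from the identity; its mean is at most `2 r² / m`,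
where `r = X.rank`. -/
theorem IsSparseSketch.isRandomSubspaceEmbedding [IsProbabilityMeasure Pr] {m n d : ℕ}
    {P : Ω → Matrix (Fin m) (Fin n) ℝ} (hP : IsSparseSketch Pr P) (X : Matrix (Fin n) (Fin d) ℝ)
    {ε δ : ℝ} (hε0 : 0 < ε) (hδ0 : 0 < δ)
    (hm : 2 * ((X.rank : ℝ) ^ 2 / δ * (1 / ε ^ 2)) ≤ m) :
    IsRandomSubspaceEmbedding Pr ε δ P X := by
  classical
  obtain ⟨h, s, hlaw, hind, hPhs⟩ := hP
  have hPf : ∀ ω, P ω = sparseMatrix fun i => (h ω i, s ω i) := by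
    intro ω
    ext j i
    simp [hPhs, sparseMatrix, boolSign]
  refine ⟨fun j i => ?_, one_sub_le_measureReal_of_compl ?_⟩
  · simp only [hPf, sparseMatrix, Matrix.of_apply]
    exact (measurable_of_finite fun q : Fin m × Bool => if j = q.1 then boolSign q.2 else 0)
      |>.comp_aemeasurable (hlaw i).aemeasurable
  rcases Nat.eq_zero_or_pos X.rank with hr | hr
  · have : {ω | IsSubspaceEmbedding ε (P ω) X}ᶜ = ∅ := by
      simp [isSubspaceEmbedding_of_rank_eq_zero hr]
    rw [this]
    simpa using hδ0.le
  have hrR : (0 : ℝ) < X.rank := by exact_mod_cast hr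
  have hm0 : (0 : ℝ) < m := lt_of_lt_of_le (by positivity) hm
  have : NeZero m := ⟨by rintro rfl; simp at hm0⟩
  set r := Module.finrank ℝ (colSpace X)
  let u : OrthonormalBasis (Fin r) ℝ (colSpace X) := stdOrthonormalBasis ℝ (colSpace X)
  have hrr : r = X.rank := finrank_colSpace X
  set v : Fin r → Fin n → ℝ := fun a => (u a : EuclideanSpace ℝ (Fin n)).ofLp with hv
  have hv1 : ∀ a, ∑ i, v a i ^ 2 = 1 := by
    intro a
    rw [← l2norm_sq_eq_sum, hv, ← norm_colSpace, u.norm_eq_one, one_pow]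
  set N : ℝ := ((Fintype.card (Fin n → Fin m × Bool) : ℕ) : ℝ) with hN
  have hN0 : 0 < N := by
    exact Nat.cast_pos.2 Fintype.card_pos
  -- the squared Frobenius norm of the deviation of the Gram matrix from the identity
  set Q : (Fin n → Fin m × Bool) → ℝ := fun f => ∑ q : Fin r × Fin r,
    (∑ p : Fin n × Fin n, v q.1 p.1 * v q.2 p.2 * collision p f) ^ 2 with hQ
  have hQ0 : ∀ f, 0 ≤ Q f := fun f => Finset.sum_nonneg fun _ _ => sq_nonneg _
  have hQsum : (m : ℝ) * ∑ f, Q f ≤ N * (2 * (r : ℝ) ^ 2) := by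
    rw [hQ, Finset.sum_comm, Finset.mul_sum]
    have hterm : ∀ q : Fin r × Fin r, (m : ℝ) * ∑ f : Fin n → Fin m × Bool,
        (∑ p : Fin n × Fin n, v q.1 p.1 * v q.2 p.2 * collision p f) ^ 2 ≤ N * 2 := by
      intro q
      refine (mul_sum_sq_sum_collision_le fun p => v q.1 p.1 * v q.2 p.2).trans (le_of_eq ?_)
      have hprod : ∑ p : Fin n × Fin n, (v q.1 p.1 * v q.2 p.2) ^ 2 =
          (∑ i, v q.1 i ^ 2) * ∑ j, v q.2 j ^ 2 := by
        simp_rw [mul_pow]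
        rw [Finset.sum_mul_sum, Fintype.sum_prod_type]
      rw [hprod, hv1, hv1]
      ring
    refine (Finset.sum_le_sum fun q _ => hterm q).trans (le_of_eq ?_)
    simp
    ring
  set A : Finset (Fin n → Fin m × Bool) := {f | ε ^ 2 < Q f} with hA
  have hsub : {ω | IsSubspaceEmbedding ε (P ω) X}ᶜ ⊆ {ω | (fun i => (h ω i, s ω i)) ∈ A} := by
    intro ω hω
    by_contra hnot
    refine hω (isSubspaceEmbedding_of_colSpaceMap
      (abs_norm_sq_sub_le_of_gram u _ hε0.le ?_))
    have hle : Q (fun i => (h ω i, s ω i)) ≤ ε ^ 2 := by simpa [hA] using hnot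
    refine le_trans (le_of_eq (Finset.sum_congr rfl fun q _ => ?_)) hle
    rw [← sparseMatrix_mulVec_dotProduct, ← hPf]
    have e1 : inner ℝ (colSpaceMap (P ω) X (u q.1)) (colSpaceMap (P ω) X (u q.2)) =
        (P ω *ᵥ v q.1) ⬝ᵥ (P ω *ᵥ v q.2) := by
      rw [dotProduct_comm]; rfl
    have e2 : inner ℝ (u q.1) (u q.2) = v q.1 ⬝ᵥ v q.2 := by
      rw [dotProduct_comm]; rfl
    rw [e1, e2]
  -- Markov's inequality
  have hmarkov : (m : ℝ) * (A.card * ε ^ 2) ≤ N * (2 * (r : ℝ) ^ 2) := by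
    refine le_trans (mul_le_mul_of_nonneg_left ?_ hm0.le) hQsum
    calc (A.card : ℝ) * ε ^ 2 ≤ ∑ f ∈ A, Q f := by
          rw [← nsmul_eq_mul]
          exact Finset.card_nsmul_le_sum _ _ _ fun f hf => (by simpa [hA] using hf : _ < _).le
      _ ≤ ∑ f, Q f := Finset.sum_le_sum_of_subset_of_nonneg (Finset.subset_univ _)
          fun f _ _ => hQ0 f
  refine (measureReal_mono hsub (measure_ne_top _ _)).trans ?_
  rw [measureReal_preimage_of_uniform hlaw hind, ← hN, div_le_iff₀ hN0]
  rw [← hrr] at hm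
  have hm2 : 2 * (r : ℝ) ^ 2 ≤ m * (δ * ε ^ 2) := by
    have := mul_le_mul_of_nonneg_right hm (by positivity : 0 ≤ δ * ε ^ 2)
    refine le_trans (le_of_eq ?_) this
    field_simp
  have h3 : m * ε ^ 2 * A.card ≤ m * ε ^ 2 * (δ * N) := by
    nlinarith [mul_le_mul_of_nonneg_left hm2 hN0.le]
  exact le_of_mul_le_mul_left h3 (by positivity)

/-! ### Sub-Gaussian noise -/

theorem hasSubgaussianMGF_mono {Z : Ω → ℝ} {c c' : ℝ≥0} (h : HasSubgaussianMGF Z c Pr)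
    (hc : c ≤ c') : HasSubgaussianMGF Z c' Pr where
  integrable_exp_mul := h.integrable_exp_mul
  mgf_le t := (h.mgf_le t).trans (Real.exp_le_exp.2 (by
    have : (c : ℝ) ≤ c' := hc
    gcongr))

/-- With probability at least `1 - 2 / d`, all columns of `X` are nearly uncorrelated with the
noise: at the threshold `2 σ √(log d / n)` each of the `d` two-sided tails is at most `2 / d²`. -/
theorem measureReal_noise_correlation_le [IsProbabilityMeasure Pr] {n d : ℕ} (hn : 0 < n)
    (hd : 0 < d) {X : Matrix (Fin n) (Fin d) ℝ} (hcol : ∀ j, ∑ i, X i j ^ 2 ≤ 1) {σ : ℝ≥0}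
    (hσ : 0 < σ) {noise : Ω → Fin n → ℝ}
    (hindep : iIndepFun (fun (i : Fin n) ω => noise ω i) Pr)
    (hsub : ∀ i, HasSubgaussianMGF (fun ω => noise ω i) (σ ^ 2) Pr) :
    Pr.real {ω | ∀ j, |(Xᵀ *ᵥ ((√(n : ℝ))⁻¹ • noise ω)) j| ≤
      2 * σ * √(Real.log d / n)}ᶜ ≤ 2 / (d : ℝ) := by
  have hnR : (0 : ℝ) < n := by exact_mod_cast hn
  have hdR : (0 : ℝ) < d := by exact_mod_cast hd
  have hσR : (0 : ℝ) < σ := hσ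
  have hlog : 0 ≤ Real.log d := Real.log_natCast_nonneg d
  set τ : ℝ := 2 * σ * √(Real.log d / n) with hτ
  have hτ0 : 0 ≤ τ := by positivity
  set S : Fin d → Ω → ℝ := fun j ω => (Xᵀ *ᵥ ((√(n : ℝ))⁻¹ • noise ω)) j with hS
  have hSsum : ∀ j ω, S j ω = ∑ i, (X i j * (√(n : ℝ))⁻¹) * noise ω i := by
    intro j ω
    simp [hS, Matrix.mulVec, dotProduct, mul_assoc]
  have hSsub : ∀ j, HasSubgaussianMGF (S j) (σ ^ 2 / n) Pr := by
    intro j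
    have h1 := HasSubgaussianMGF.sum_of_iIndepFun (s := Finset.univ)
      (hindep.comp (fun i x => (X i j * (√(n : ℝ))⁻¹) * x) fun i => by fun_prop)
      fun i _ => (hsub i).const_mul (X i j * (√(n : ℝ))⁻¹)
    have h2 : (fun ω => ∑ i, ((fun x => (X i j * (√(n : ℝ))⁻¹) * x) ∘ fun ω => noise ω i) ω) =
        S j := by
      ext ω; rw [hSsum]; rfl
    rw [h2] at h1
    refine hasSubgaussianMGF_mono h1 ?_
    rw [← NNReal.coe_le_coe]
    push_cast
    change ∑ i, (X i j * (√(n : ℝ))⁻¹) ^ 2 * (σ : ℝ) ^ 2 ≤ _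
    rw [← Finset.sum_mul]
    simp_rw [mul_pow, inv_pow, Real.sq_sqrt hnR.le]
    rw [← Finset.sum_mul, ← div_eq_mul_inv, div_mul_eq_mul_div]
    gcongr
    exact mul_le_of_le_one_left (sq_nonneg _) (hcol j)
  have hexp : Real.exp (-τ ^ 2 / (2 * ((σ ^ 2 / n : ℝ≥0) : ℝ))) = ((d : ℝ) ^ 2)⁻¹ := by
    have h1 : -τ ^ 2 / (2 * ((σ ^ 2 / n : ℝ≥0) : ℝ)) = -Real.log ((d : ℝ) ^ 2) := by
      push_cast
      rw [hτ, mul_pow, Real.sq_sqrt (by positivity), Real.log_pow]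
      field_simp
      push_cast
      ring
    rw [h1, Real.exp_neg, Real.exp_log (by positivity)]
  have htail : ∀ j, Pr.real {ω | τ < |S j ω|} ≤ 2 * ((d : ℝ) ^ 2)⁻¹ := by
    intro j
    have h1 := (hSsub j).measure_ge_le hτ0
    have h2 := (hSsub j).neg.measure_ge_le hτ0
    rw [hexp] at h1 h2
    have hsubset : {ω | τ < |S j ω|} ⊆ {ω | τ ≤ S j ω} ∪ {ω | τ ≤ (-S j) ω} := by
      intro ω hω
      rcases lt_abs.1 (show τ < |S j ω| from hω) with h | h
      · exact Or.inl h.le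
      · exact Or.inr h.le
    refine (measureReal_mono hsubset (measure_ne_top _ _)).trans
      ((measureReal_union_le _ _).trans ?_)
    linarith
  have hsubset : {ω | ∀ j, |S j ω| ≤ τ}ᶜ ⊆ ⋃ j ∈ (Finset.univ : Finset (Fin d)),
      {ω | τ < |S j ω|} := by
    intro ω hω
    have : ∃ j, τ < |S j ω| := by
      by_contra! hno
      exact hω hno
    obtain ⟨j, hj⟩ := this
    exact Set.mem_biUnion (Finset.mem_univ j) hj
  calc Pr.real {ω | ∀ j, |S j ω| ≤ τ}ᶜ ≤ _ := measureReal_mono hsubset (measure_ne_top _ _)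
    _ ≤ ∑ j, Pr.real {ω | τ < |S j ω|} := measureReal_biUnion_finset_le _ _
    _ ≤ ∑ _j : Fin d, 2 * ((d : ℝ) ^ 2)⁻¹ := Finset.sum_le_sum fun j _ => htail j
    _ = 2 / (d : ℝ) := by
        simp
        field_simp

/-! ### Admissible sketches and the error bound -/

/-- A positive sparse eigenvalue rules out empty designs: an infimum over the empty set is `0`, and
without rows all sparse eigenvalues vanish. -/
theorem SparseEigenvalueCondition.pos {n d : ℕ} {X : Matrix (Fin n) (Fin d) ℝ} {s k : ℕ}
    (h : SparseEigenvalueCondition X s k) : 0 < n ∧ 0 < d := by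
  have h0 := h.sparseEigMin_pos
  obtain ⟨r, v, hv, hv1, -⟩ : {r : ℝ | ∃ v : Fin d → ℝ,
      hammingNorm v ≤ 2 * k + s ∧ l2norm v = 1 ∧ r = v ⬝ᵥ ((Xᵀ * X) *ᵥ v)}.Nonempty := by
    by_contra hne
    rw [Set.not_nonempty_iff_eq_empty] at hne
    rw [sparseEigMin, hne, Real.sInf_empty] at h0
    exact lt_irrefl _ h0
  constructor
  · rw [Nat.pos_iff_ne_zero]
    rintro rfl
    have h1 := sparseEigMin_mul_sq_le X hv
    rw [hv1, Subsingleton.elim (X *ᵥ v) 0, l2norm_zero] at h1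
    norm_num at h1
    linarith
  · rw [Nat.pos_iff_ne_zero]
    rintro rfl
    rw [Subsingleton.elim v 0, l2norm_zero] at hv1
    norm_num at hv1

/-- All admissible sketches embed the column space of `X` with failure probability `δ`. -/
theorem AdmissibleSketch.measureReal_compl_le [IsProbabilityMeasure Pr] {m n d : ℕ} {ρ δ : ℝ}
    {P : Ω → Matrix (Fin m) (Fin n) ℝ} {X : Matrix (Fin n) (Fin d) ℝ}
    (hP : AdmissibleSketch Pr 1280 ρ δ P X) (hρ : ρ ∈ Set.Ioo (0 : ℝ) 1)
    (hδ : δ ∈ Set.Ioo (0 : ℝ) 1) :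
    Pr.real {ω | IsSubspaceEmbedding (ρ / (ρ + 1)) (P ω) X}ᶜ ≤ δ := by
  have hρ0 := hρ.1
  have hδ0 := hδ.1
  have hε0 : 0 < ρ / (ρ + 1) := by positivity
  have hε1 : ρ / (ρ + 1) ≤ 1 := by rw [div_le_one (by positivity)]; linarith
  have hεeq : (ρ + 1) ^ 2 / ρ ^ 2 = 1 / (ρ / (ρ + 1)) ^ 2 := by field_simp
  have hR : IsRandomSubspaceEmbedding Pr (ρ / (ρ + 1)) δ P X := by
    rcases hP with hP | ⟨hP, hm⟩ | ⟨hP, hm⟩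
    · exact hP
    · rw [hεeq] at hm
      exact hP.isRandomSubspaceEmbedding X hε0 hε1 hδ0 hδ.2 hm
    · rw [hεeq] at hm
      -- the constant `2` suffices for sparse sketches
      refine hP.isRandomSubspaceEmbedding X hε0 hδ0 (le_trans ?_ hm)
      gcongr
      norm_num
  rw [probReal_compl_eq_one_sub₀ (nullMeasurableSet_isSubspaceEmbedding hR.1 _ X)]
  linarith [hR.2]

end SketchedLasso

theorem mainTheorem6 :
    ∃ C : ℝ, 0 < C ∧
      ∀ {Ω : Type*} [MeasurableSpace Ω] (Pr : Measure Ω) [IsProbabilityMeasure Pr]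
        {m n d : ℕ}
        -- design matrix with columns of norm at most `√n`, sparse parameter
        (Xbar : Matrix (Fin n) (Fin d) ℝ)
        (_hcol : ∀ j, SketchedLasso.l2norm (fun i => Xbar i j) ≤ √(n : ℝ))
        (βbar : Fin d → ℝ)
        -- i.i.d. sub-Gaussian noise with variance proxy `σ²`
        (σ : ℝ≥0) (_hσ : 0 < σ) (noise : Ω → Fin n → ℝ)
        (_hindep : iIndepFun (fun (i : Fin n) ω => noise ω i) Pr)
        (_hident : ∀ i j, IdentDistrib (fun ω => noise ω i) (fun ω => noise ω j) Pr Pr)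
        (_hsub : ∀ i, HasSubgaussianMGF (fun ω => noise ω i) (σ ^ 2) Pr)
        -- normalized data
        (X : Matrix (Fin n) (Fin d) ℝ) (_hX : X = (√(n : ℝ))⁻¹ • Xbar)
        (y : Ω → Fin n → ℝ)
        (_hy : ∀ ω, y ω = (√(n : ℝ))⁻¹ • (Xbar *ᵥ βbar + noise ω))
        -- sparse eigenvalue assumption
        (k : ℕ) (_hk : SketchedLasso.SparseEigenvalueCondition X (hammingNorm βbar) k)
        -- parameters
        (c μ γ ρ δ lam : ℝ) (_hc : 0 < c) (_hμ : 0 < μ) (_hμc : μ + 2 / c < 1)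
        (_hγ : γ = (1 + μ + 2 / c) / (1 - μ - 2 / c)) (_hγ1 : γ * √(0.5 : ℝ) < 1)
        (_hρ : ρ ∈ Set.Ioo (0 : ℝ) 1) (_hδ : δ ∈ Set.Ioo (0 : ℝ) 1)
        (_hlam : lam = c * σ * √(Real.log d / n))
        -- random sketching matrix
        (P : Ω → Matrix (Fin m) (Fin n) ℝ)
        (_hP : SketchedLasso.AdmissibleSketch Pr C ρ δ P X),
        ∃ E : Set Ω, MeasurableSet E ∧ 1 - δ - 2 / (d : ℝ) ≤ Pr.real E ∧
          ∀ ω ∈ E, ∀ βstar : Fin d → ℝ,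
            IsMinOn (SketchedLasso.objective X (y ω) (fun β => lam * SketchedLasso.l1norm β))
              Set.univ βstar →
            ∀ N : ℕ, SketchedLasso.iterationNumber X lam μ ρ βstar ≤ N →
            ∀ β : ℕ → Fin d → ℝ,
              SketchedLasso.IsIterativeSRORun X (P ω * X) (y ω)
                (fun β => lam * SketchedLasso.l1norm β) N β →
              SketchedLasso.l2norm (β N - βbar) ≤
                σ * (c + μ * c + 2) /
                    (SketchedLasso.sparseEigMin X (hammingNorm βbar + k) *
                      (1 - γ * √(0.5 : ℝ))) *
                  √((hammingNorm βbar : ℝ) * Real.log d / n) := by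
  refine ⟨1280, by norm_num, ?_⟩
  intro Ω _ Pr _ m n d Xbar hcol βbar σ hσ noise hindep _ hsub X hX y hy k hk c μ γ ρ δ lam
    hc hμ hμc hγ hγ1 hρ hδ hlam P hP
  obtain ⟨hn, hd⟩ := hk.pos
  have hnR : (0 : ℝ) < n := by exact_mod_cast hn
  have hσR : (0 : ℝ) < σ := hσ
  rcases (Nat.succ_le_iff.2 hd).eq_or_lt with hd1 | hd2
  · -- for `d = 1` the claimed probability is not positive
    refine ⟨∅, MeasurableSet.empty, ?_, fun ω hω => absurd hω (Set.notMem_empty ω)⟩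
    have := hδ.1
    rw [← hd1]
    norm_num
    linarith
  have hlog : 0 < Real.log d := Real.log_pos (by exact_mod_cast hd2)
  have hlam0 : 0 < lam := by
    rw [hlam]
    have : 0 < √(Real.log d / n) := Real.sqrt_pos.2 (by positivity)
    positivity
  have hcolX : ∀ j, ∑ i, X i j ^ 2 ≤ 1 := by
    intro j
    have h1 := pow_le_pow_left₀ (SketchedLasso.l2norm_nonneg _) (hcol j) 2
    rw [SketchedLasso.l2norm_sq_eq_sum, Real.sq_sqrt hnR.le] at h1
    simp only [hX, Matrix.smul_apply, smul_eq_mul, mul_pow, inv_pow, Real.sq_sqrt hnR.le]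
    rw [← Finset.mul_sum, inv_mul_le_one₀ hnR]
    exact h1
  set G1 : Set Ω := {ω | SketchedLasso.IsSubspaceEmbedding (ρ / (ρ + 1)) (P ω) X} with hG1
  set G2 : Set Ω := {ω | ∀ j, |(Xᵀ *ᵥ ((√(n : ℝ))⁻¹ • noise ω)) j| ≤
    2 * σ * √(Real.log d / n)} with hG2
  have hp1 : Pr.real G1ᶜ ≤ δ := hP.measureReal_compl_le hρ hδ
  have hp2 : Pr.real G2ᶜ ≤ 2 / (d : ℝ) :=
    SketchedLasso.measureReal_noise_correlation_le hn hd hcolX hσ hindep hsub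
  -- the exceptional set is enlarged to a measurable one of the same measure
  refine ⟨(toMeasurable Pr (G1ᶜ ∪ G2ᶜ))ᶜ, (measurableSet_toMeasurable _ _).compl, ?_, ?_⟩
  · rw [probReal_compl_eq_one_sub (measurableSet_toMeasurable _ _), Measure.real,
      measure_toMeasurable]
    have h1 := measureReal_union_le (μ := Pr) G1ᶜ G2ᶜ
    rw [Measure.real] at h1
    linarith
  intro ω hω βstar hstar N hN β hrun
  have hnot : ω ∉ G1ᶜ ∪ G2ᶜ := fun h => hω (subset_toMeasurable _ _ h)
  rw [Set.mem_union, not_or, Set.notMem_compl_iff, Set.notMem_compl_iff] at hnot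
  obtain ⟨hω1, hω2⟩ := hnot
  obtain ⟨g, hg, hgrad⟩ :=
    SketchedLasso.run_nearly_stationary hlam0 hμ hρ hω1 hstar hN hrun
  have hyω : y ω = X *ᵥ βbar + (√(n : ℝ))⁻¹ • noise ω := by
    rw [hy, smul_add, hX, Matrix.smul_mulVec]
  -- the noise adds `2 lam / c` to the stationarity error `lam μ` of the last iterate
  have hgrad2 : ∀ j, |(Xᵀ *ᵥ (X *ᵥ (β N - βbar))) j - g j| ≤ lam * (μ + 2 / c) := by
    intro j
    have e : (Xᵀ *ᵥ (X *ᵥ (β N - βbar))) j - g j =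
        ((Xᵀ *ᵥ (X *ᵥ β N - y ω)) j - g j) + (Xᵀ *ᵥ ((√(n : ℝ))⁻¹ • noise ω)) j := by
      have : X *ᵥ (β N - βbar) = (X *ᵥ β N - y ω) + (√(n : ℝ))⁻¹ • noise ω := by
        rw [hyω, Matrix.mulVec_sub]; abel
      rw [this, Matrix.mulVec_add, Pi.add_apply]
      ring
    have h2 : 2 * σ * √(Real.log d / n) = lam * (2 / c) := by
      rw [hlam]; field_simp
    rw [e, mul_add, ← h2]
    exact (abs_add_le _ _).trans (add_le_add (hgrad j) (hω2 j))
  have hγ' : γ = (1 + (μ + 2 / c)) / (1 - (μ + 2 / c)) := by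
    rw [hγ, add_assoc, sub_sub]
  have hmain := SketchedLasso.l2norm_sub_le_of_nearly_stationary hk hd hlam0
    (by positivity : 0 ≤ μ + 2 / c) hμc (by rwa [← hγ']) hg hgrad2
  rw [← hγ'] at hmain
  refine hmain.trans (le_of_eq ?_)
  have h3 : lam * (1 + (μ + 2 / c)) = σ * (c + μ * c + 2) * √(Real.log d / n) := by
    rw [hlam]; field_simp; ring
  rw [h3, mul_div_assoc (hammingNorm βbar : ℝ), Real.sqrt_mul (Nat.cast_nonneg _)]
  ring
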